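/- **Theorem 4.1.** Let $G=(V,E)$ be a tree on $n$ nodes and let $0<\delta<1/2$ be a constant. In *asynchronous majority dynamics* on $G$ the nodes hold independent private signals $X(v)\in\{0,1\}$ ($1$ = Correct, $0$ = Incorrect) with $\Pr[X(v)=1]=1/2+\delta$. Initially no node has made an announcement. In each step one node $v$, chosen uniformly at random from $V$ and independently of the other choices and of the signals, updates its announcement: it announces $1$ if strictly more of its neighbors currently announce $1$ than $0$, it announces $0$ if strictly more announce $0$ than $1$, and it announces $X(v)$ in case of a tie; all other announcements stay the same. (a) There are constants $K>0$ and $N$, depending only on $\delta$, such that for every $n\ge N$, every tree on $n$ nodes and every integer $T$ with $0\le T\le \frac{n\ln n}{32\ln\ln n}$: after $T$ steps, with probability at least $$1-K\,e^{-\ln n/(24\ln\ln n)},$$ the announcements of at least $\bigl(\tfrac12+\tfrac\delta2-e^{-T/n}\bigr)n$ nodes are Correct. (b) For every constant $\gamma>0$ there is a constant $\alpha>0$ such that for all sufficiently large $n$ (how large depends only on $\delta$ and $\gamma$), every tree on $n$ nodes and every integer $T$ with $0\le T\le \frac{n\ln^{1-\gamma}n}{\ln\ln n}$: after $T$ steps,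 with probability at least $1-n^{-\alpha}$, the announcements of at least $\bigl(\tfrac12+\tfrac\delta2-e^{-T/n}\bigr)n$ nodes are Correct. (Here $\alpha$ depends only on $\delta$ and $\gamma$.) -/

import Mathlib

open MeasureTheory ProbabilityTheory

universe u

namespace MajorityDynamics

variable {V : Type u} [Fintype V]

open Classical in
/-- The number of neighbors of `v` in `G` whose announcement in the profile `C` is `b`.
An announcement is an element of `Option Bool`: `none` is "no announcement yet" (`⊥`),
`some true` is Correct and `some false` is Incorrect. -/
noncomputable def nbrCount (G : SimpleGraph V) (C : V → Option Bool) (b : Bool) (v : V) : ℕ :=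
  (Finset.univ.filter fun w => G.Adj v w ∧ C w = some b).card

/-- What `v` announces when it is selected: the majority of its neighbors' announcements, and
its private signal `X v` in case of a tie. -/
noncomputable def majorityVote (G : SimpleGraph V) (X : V → Bool) (C : V → Option Bool)
    (v : V) : Bool :=
  if nbrCount G C false v < nbrCount G C true v then true
  else if nbrCount G C true v < nbrCount G C false v then false
  else X v

open Classical in
/-- `announcement G X s t v` is the announcement of node `v` after `t` steps of asynchronous
majority dynamics with private signals `X`, where `s k` is the node selected in the
`(k + 1)`-st step. -/
noncomputable def announcement (G : SimpleGraph V) (X : V → Bool) (s : ℕ → V) :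
    ℕ → V → Option Bool
  | 0 => fun _ => none
  | t + 1 => fun v =>
      if v = s t then some (majorityVote G X (announcement G X s t) v)
      else announcement G X s t v

open Classical in
/-- The number of nodes whose announcement after `t` steps is Correct. -/
noncomputable def numCorrect (G : SimpleGraph V) (X : V → Bool) (s : ℕ → V) (t : ℕ) : ℕ :=
  (Finset.univ.filter fun v => announcement G X s t v = some true).card

/-- The law of one private signal: Correct (`true`) with probability `1/2 + δ`, Incorrect with
probability `1/2 - δ`. -/
noncomputable def signalLaw (δ : ℝ) : Measure Bool :=
  ENNReal.ofReal (1 / 2 + δ) • Measure.dirac true +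
    ENNReal.ofReal (1 / 2 - δ) • Measure.dirac false

/-- The joint law of the private signals and of the sequence of selected nodes: the signals are
i.i.d. with law `signalLaw δ`, the selected nodes are i.i.d. uniform on `V`, and the signals are
independent of the selected nodes. -/
noncomputable def processLaw (V : Type u) [Fintype V] [MeasurableSpace V] (δ : ℝ) :
    Measure ((V → Bool) × (ℕ → V)) :=
  (Measure.pi fun _ : V => signalLaw δ).prod
    (Measure.infinitePi fun _ : ℕ => uniformOn (Set.univ : Set V))

/-- The probability that, after `T` steps of asynchronous majority dynamics on `G`, at least `x`
nodes announce Correct. -/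
noncomputable def probCorrect [MeasurableSpace V] (G : SimpleGraph V) (δ : ℝ) (T : ℕ) (x : ℝ) :
    ℝ :=
  (processLaw V δ).real {ω | x ≤ (numCorrect G ω.1 ω.2 T : ℝ)}

end MajorityDynamics

/-!
Fix the schedule, and regard the announcements after `T` steps as functions of the signals.

*Mean.* The announcement of a selected node is a monotone function of the signals and commutes with
exchanging the two opinions. Such a function is Correct with probability at least `1/2 + δ`
(`integral_ge_of_monotone_of_selfDual`, by comparing the odds of a monotone event under the biases
`δ` and `-δ`). As only about `e^(-T/n) n` nodes are still unselected
(`scheduleMeasure_real_lt_numUnselected_le`), the mean number of Correct announcements exceeds the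
number claimed by almost `δ n / 2` or more, and Chebyshev's inequality applies once the covariances
`correctnessCov` of the announcements of two nodes `u`, `v` are small for most pairs and schedules.

*Distant nodes.* Signals travel along walks whose vertices are selected in order
(`dependsOn_announcement`). If the path from `u` to `v` has length at least `2 R`, a signal reaching
both ends passes the node at distance `R` from `u`, and hence travels at least `R` steps along the
path. This has probability at most `2 (T choose R) / n^R` (`scheduleMeasure_real_sublist_le`).

*Close nodes.* If a node `w` between `u` and `v` is selected only after `M` of its neighbors, then
it is Correct throughout with high probability. Indeed, as long as it is, monotonicity shows that
its neighbors do at least as well as if `w` were silent; in that case they are independent, since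
they lie in different components of the tree without `w`, and a Chernoff bound applies
(`integral_majorityVote_ne_true_le`). Replacing `w` by a node which always announces Correct makes
`u` and `v` independent (`correctnessCov_le`). So `u` and `v` are correlated only if every node `w`
between them is selected before `M` of its neighbors off the path. By symmetry these events have
probability about `M / deg w`, independently
(`scheduleMeasure_real_inter_early_mul_le`). The product of the numbers `1 / (deg w - 1)` over the
inner nodes is the probability that a non-backtracking random walk follows the path, so the sum over
all pairs at distance `r + 1` is at most `2 n M^r`, however large the degrees are
(`sum_sum_nonbacktrackingProb_le`).

With `M` of order `ln n` and `R` about `ln n / (6 ln ln n)` the close pairs contribute a power of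
`1 / n`, and the distant pairs contribute `exp (-ln n / (24 ln ln n))` in part (a) and a power of
`1 / n` in part (b).
-/

namespace MajorityDynamics

/-! ### Independent private signals -/

section Signals

variable {V : Type u} [Fintype V] {δ : ℝ}

lemma isProbabilityMeasure_signalLaw (h₁ : -(1 / 2) ≤ δ) (h₂ : δ ≤ 1 / 2) :
    IsProbabilityMeasure (signalLaw δ) := by
  constructor
  simp only [signalLaw, Measure.coe_add, Measure.coe_smul, Pi.add_apply, Pi.smul_apply,
    measure_univ, smul_eq_mul, mul_one]
  rw [← ENNReal.ofReal_add (by linarith) (by linarith)]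
  norm_num

/-- The joint law of the private signals of all nodes. -/
noncomputable abbrev signalMeasure (V : Type u) [Fintype V] (δ : ℝ) : Measure (V → Bool) :=
  Measure.pi fun _ : V => signalLaw δ

lemma integral_mul_of_dependsOn [IsProbabilityMeasure (signalLaw δ)] {f g : (V → Bool) → ℝ}
    {S T : Set V} (hf : DependsOn f S) (hg : DependsOn g T) (hST : Disjoint S T) :
    ∫ X, f X * g X ∂signalMeasure V δ =
      (∫ X, f X ∂signalMeasure V δ) * ∫ X, g X ∂signalMeasure V δ := by
  classical
  have hi : iIndepFun (fun (v : V) (X : V → Bool) => X v) (signalMeasure V δ) :=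
    iIndepFun_pi (X := fun _ x => x) fun _ => aemeasurable_id
  have h2 := hi.indepFun_finset S.toFinset T.toFinset (by simpa using hST)
    (fun i => measurable_pi_apply i)
  have ext : ∀ (h : (V → Bool) → ℝ) (A : Set V), DependsOn h A →
      ∃ φ : (A.toFinset → Bool) → ℝ, h = φ ∘ fun X (i : A.toFinset) => X i := by
    intro h A hA
    refine ⟨fun y => h fun v => if hv : v ∈ A.toFinset then y ⟨v, hv⟩ else true, ?_⟩
    funext X
    refine hA fun v hv => ?_
    simp [hv]
  obtain ⟨φ, hφ⟩ := ext f S hf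
  obtain ⟨ψ, hψ⟩ := ext g T hg
  have h3 : IndepFun f g (signalMeasure V δ) := by
    rw [hφ, hψ]
    exact h2.comp (measurable_of_finite φ) (measurable_of_finite ψ)
  exact h3.integral_fun_mul_eq_mul_integral (measurable_of_finite f).aestronglyMeasurable
    (measurable_of_finite g).aestronglyMeasurable

omit [Fintype V] in
lemma dependsOn_finset_prod {ι : Type*} (I : Finset ι) {g : ι → (V → Bool) → ℝ} {S : ι → Set V}
    (hg : ∀ i ∈ I, DependsOn (g i) (S i)) :
    DependsOn (fun X => ∏ i ∈ I, g i X) (⋃ i ∈ I, S i) := by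
  intro X Y h
  refine Finset.prod_congr rfl fun i hi => hg i hi fun v hv => h v ?_
  simp only [Set.mem_iUnion]
  exact ⟨i, hi, hv⟩

lemma integral_prod_of_dependsOn [IsProbabilityMeasure (signalLaw δ)] {ι : Type*} (I : Finset ι)
    {g : ι → (V → Bool) → ℝ} {S : ι → Set V} (hg : ∀ i ∈ I, DependsOn (g i) (S i))
    (hS : (I : Set ι).PairwiseDisjoint S) :
    ∫ X, ∏ i ∈ I, g i X ∂signalMeasure V δ = ∏ i ∈ I, ∫ X, g i X ∂signalMeasure V δ := by
  classical
  induction I using Finset.induction_on with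
  | empty => simp
  | insert a I ha ih =>
    simp only [Finset.prod_insert ha]
    rw [integral_mul_of_dependsOn (hg a (by simp))
      (dependsOn_finset_prod I fun i hi => hg i (by simp [hi])), ih]
    · exact fun i hi => hg i (by simp [hi])
    · exact hS.subset (by simp)
    · simp only [Set.disjoint_iUnion_right]
      intro i hi
      exact hS (by simp) (by simp [hi]) (by rintro rfl; exact ha hi)

lemma integral_signal [IsProbabilityMeasure (signalLaw δ)] (h₁ : -(1 / 2) ≤ δ) (h₂ : δ ≤ 1 / 2)
    (w : V) (φ : Bool → ℝ) :
    ∫ X, φ (X w) ∂signalMeasure V δ = (1 / 2 + δ) * φ true + (1 / 2 - δ) * φ false := by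
  have h := (measurePreserving_eval (fun _ : V => signalLaw δ) w).map_eq
  have h' := integral_map (μ := signalMeasure V δ) (measurable_pi_apply w).aemeasurable
    (f := φ) (measurable_of_finite φ).aestronglyMeasurable
  change Measure.map (fun X : V → Bool => X w) _ = _ at h
  rw [← h', h, signalLaw, integral_add_measure, integral_smul_measure, integral_smul_measure,
    integral_dirac, integral_dirac, ENNReal.toReal_ofReal (by linarith),
    ENNReal.toReal_ofReal (by linarith), smul_eq_mul, smul_eq_mul]
  · exact (integrable_dirac (by simp)).smul_measure (by simp)
  · exact (integrable_dirac (by simp)).smul_measure (by simp)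

lemma integral_split [IsProbabilityMeasure (signalLaw δ)] [DecidableEq V]
    (h₁ : -(1 / 2) ≤ δ) (h₂ : δ ≤ 1 / 2) (w : V) (f : (V → Bool) → ℝ) :
    ∫ X, f X ∂signalMeasure V δ =
      (1 / 2 + δ) * ∫ X, f (Function.update X w true) ∂signalMeasure V δ +
      (1 / 2 - δ) * ∫ X, f (Function.update X w false) ∂signalMeasure V δ := by
  have key : ∀ X : V → Bool, f X =
      (if X w then 1 else 0) * f (Function.update X w true) +
      (if X w then 0 else 1) * f (Function.update X w false) := by
    intro X
    have hu : Function.update X w (X w) = X := Function.update_eq_self w X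
    cases h : X w <;> rw [h] at hu <;> simp [hu]
  have hdep : ∀ b, DependsOn (fun X : V → Bool => f (Function.update X w b)) {w}ᶜ := by
    intro b X Y h
    refine congrArg f (funext fun v => ?_)
    by_cases hv : v = w
    · simp [hv]
    · simp [hv, h v hv]
  have hdep' : ∀ φ : Bool → ℝ, DependsOn (fun X : V → Bool => φ (X w)) {w} := by
    intro φ X Y h
    simp [h w rfl]
  have e1 := integral_mul_of_dependsOn (δ := δ) (hdep' fun b => if b then 1 else 0) (hdep true)
    disjoint_compl_right
  have e2 := integral_mul_of_dependsOn (δ := δ) (hdep' fun b => if b then 0 else 1) (hdep false)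
    disjoint_compl_right
  rw [integral_signal h₁ h₂ w fun b => if b then 1 else 0] at e1
  rw [integral_signal h₁ h₂ w fun b => if b then 0 else 1] at e2
  calc ∫ X, f X ∂signalMeasure V δ
      = ∫ X, ((if X w then 1 else 0) * f (Function.update X w true) +
        (if X w then 0 else 1) * f (Function.update X w false)) ∂signalMeasure V δ :=
        integral_congr_ae (Filter.Eventually.of_forall key)
    _ = _ := by
        rw [integral_add Integrable.of_finite Integrable.of_finite, e1, e2]
        simp

lemma integral_comp_not (h₁ : -(1 / 2) ≤ δ) (h₂ : δ ≤ 1 / 2) (f : (V → Bool) → ℝ) :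
    ∫ X, f (fun v => !X v) ∂signalMeasure V δ = ∫ X, f X ∂signalMeasure V (-δ) := by
  have := isProbabilityMeasure_signalLaw h₁ h₂
  have hm : (signalLaw δ).map not = signalLaw (-δ) := by
    rw [signalLaw, Measure.map_add _ _ (measurable_of_finite _), Measure.map_smul,
      Measure.map_smul, Measure.map_dirac' (measurable_of_finite _),
      Measure.map_dirac' (measurable_of_finite _), signalLaw, add_comm]
    simp [sub_eq_add_neg]
  have : IsProbabilityMeasure ((signalLaw δ).map not) :=
    Measure.isProbabilityMeasure_map (measurable_of_finite _).aemeasurable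
  have h := Measure.pi_map_pi (μ := fun _ : V => signalLaw δ) (f := fun _ => not)
    (fun _ => (measurable_of_finite _).aemeasurable)
  simp only [hm] at h
  rw [signalMeasure, signalMeasure, ← h, integral_map (measurable_of_finite _).aemeasurable
    (measurable_of_finite _).aestronglyMeasurable]

/-- The induction step of `integral_odds_le`: splitting off one coordinate, the values `a₀ ≤ a₁`
and `b₀`, `b₁` of the two restrictions under the two laws are averaged with exchanged weights. -/
lemma odds_step {p q a₀ a₁ b₀ b₁ : ℝ} (hq : 0 < q) (hpq : q ≤ p) (hs : p + q = 1)
    (ha₀ : 0 ≤ a₀) (ha : a₀ ≤ a₁) (ha₁ : a₁ ≤ 1)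
    (h₀ : b₀ * (a₀ * q ^ 2 + (1 - a₀) * p ^ 2) ≤ a₀ * q ^ 2)
    (h₁ : b₁ * (a₁ * q ^ 2 + (1 - a₁) * p ^ 2) ≤ a₁ * q ^ 2) :
    (p * b₀ + q * b₁) * ((q * a₀ + p * a₁) * q ^ 2 + (1 - (q * a₀ + p * a₁)) * p ^ 2) ≤
      (q * a₀ + p * a₁) * q ^ 2 := by
  have hp : 0 < p := lt_of_lt_of_le hq hpq
  have hkj : q ^ 2 ≤ p ^ 2 := by gcongr
  have hD : ∀ a : ℝ, a ≤ 1 → q ^ 2 ≤ a * q ^ 2 + (1 - a) * p ^ 2 := by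
    intro a h
    nlinarith
  have hq2 : 0 < q ^ 2 := by positivity
  set D₀ := a₀ * q ^ 2 + (1 - a₀) * p ^ 2 with hD₀
  set D₁ := a₁ * q ^ 2 + (1 - a₁) * p ^ 2 with hD₁
  have hD₀' : q ^ 2 ≤ D₀ := hD a₀ (ha.trans ha₁)
  have hD₁' : q ^ 2 ≤ D₁ := hD a₁ ha₁
  have hD₀k : D₀ ≤ p ^ 2 := by
    rw [hD₀]
    nlinarith
  have hpos₀ : 0 < D₀ := by linarith
  have hpos₁ : 0 < D₁ := by linarith
  have e : (q * a₀ + p * a₁) * q ^ 2 + (1 - (q * a₀ + p * a₁)) * p ^ 2 = q * D₀ + p * D₁ := by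
    rw [hD₀, hD₁]
    linear_combination -p ^ 2 * hs
  rw [e]
  have hb₀ : b₀ ≤ a₀ * q ^ 2 / D₀ := by rwa [le_div_iff₀ hpos₀]
  have hb₁ : b₁ ≤ a₁ * q ^ 2 / D₁ := by rwa [le_div_iff₀ hpos₁]
  have hpos : 0 < q * D₀ + p * D₁ := by positivity
  have cross : a₁ * D₀ - a₀ * D₁ = p ^ 2 * (a₁ - a₀) := by
    rw [hD₀, hD₁]
    ring
  have main : p ^ 2 * a₀ * D₁ ^ 2 + q ^ 2 * a₁ * D₀ ^ 2 ≤
      (q ^ 2 * a₀ + p ^ 2 * a₁) * (D₀ * D₁) := by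
    have h3 : q ^ 2 * D₀ ≤ p ^ 2 * D₁ := by
      calc q ^ 2 * D₀ ≤ q ^ 2 * p ^ 2 := by gcongr
        _ = p ^ 2 * q ^ 2 := by ring
        _ ≤ p ^ 2 * D₁ := by gcongr
    have h4 : 0 ≤ (p ^ 2 * D₁ - q ^ 2 * D₀) * (a₁ * D₀ - a₀ * D₁) := by
      rw [cross]
      exact mul_nonneg (by linarith) (mul_nonneg (by positivity) (by linarith))
    nlinarith
  calc (p * b₀ + q * b₁) * (q * D₀ + p * D₁)
      ≤ (p * (a₀ * q ^ 2 / D₀) + q * (a₁ * q ^ 2 / D₁)) * (q * D₀ + p * D₁) := by gcongr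
    _ = q ^ 2 * (p * q * a₀ + p * q * a₁ +
          (p ^ 2 * a₀ * D₁ ^ 2 + q ^ 2 * a₁ * D₀ ^ 2) / (D₀ * D₁)) := by
        field_simp
        ring
    _ ≤ q ^ 2 * (p * q * a₀ + p * q * a₁ + (q ^ 2 * a₀ + p ^ 2 * a₁)) := by
        have : (p ^ 2 * a₀ * D₁ ^ 2 + q ^ 2 * a₁ * D₀ ^ 2) / (D₀ * D₁) ≤
            q ^ 2 * a₀ + p ^ 2 * a₁ := by
          rw [div_le_iff₀ (by positivity)]
          exact main
        gcongr
    _ = (q * a₀ + p * a₁) * q ^ 2 := by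
        have : p = 1 - q := by linarith
        subst this
        ring

/-- For a monotone event, passing from bias `-δ` to bias `δ` multiplies the odds by at least
`((1/2 + δ) / (1/2 - δ))²`, which is the exact factor for the event that one given signal is
Correct. -/
lemma integral_odds_le (h₀ : 0 ≤ δ) (h₁ : δ < 1 / 2) (S : Finset V) :
    ∀ f : (V → Bool) → ℝ, Monotone f → (∀ X, f X = 0 ∨ f X = 1) → DependsOn f (S : Set V) →
    (∫ X, f X ∂signalMeasure V (-δ)) *
      ((∫ X, f X ∂signalMeasure V δ) * (1 / 2 - δ) ^ 2 +
        (1 - ∫ X, f X ∂signalMeasure V δ) * (1 / 2 + δ) ^ 2) ≤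
      (∫ X, f X ∂signalMeasure V δ) * (1 / 2 - δ) ^ 2 := by
  classical
  have := isProbabilityMeasure_signalLaw (δ := δ) (by linarith) h₁.le
  have := isProbabilityMeasure_signalLaw (δ := -δ) (by linarith) (by linarith)
  induction S using Finset.induction_on with
  | empty =>
    intro f _ hf01 hdep
    have hc : ∀ X, f X = f fun _ => true := fun X => hdep (by simp)
    simp only [hc, integral_const, probReal_univ, smul_eq_mul, one_mul]
    rcases hf01 fun _ => true with h | h <;> simp [h]
  | insert w S hw ih =>
    intro f hmono hf01 hdep
    have hup : ∀ b, Monotone fun X : V → Bool => Function.update X w b := fun b X Y h v => by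
      by_cases hv : v = w
      · subst hv
        simp
      · simpa [hv] using h v
    have hdep' : ∀ b, DependsOn (fun X => f (Function.update X w b)) (S : Set V) := by
      intro b X Y h
      refine hdep fun v hv => ?_
      by_cases hvw : v = w
      · simp [hvw]
      · have : v ∈ S := by simpa [hvw] using hv
        simpa [hvw] using h v this
    have i₀ := ih _ (hmono.comp (hup false)) (fun X => hf01 _) (hdep' false)
    have i₁ := ih _ (hmono.comp (hup true)) (fun X => hf01 _) (hdep' true)
    rw [integral_split (δ := δ) (by linarith) h₁.le w f,
      integral_split (δ := -δ) (by linarith) (by linarith) w f]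
    have hle : ∀ X, f X ≤ 1 := fun X => by rcases hf01 X with h | h <;> simp [h]
    have hge : ∀ X, 0 ≤ f X := fun X => by rcases hf01 X with h | h <;> simp [h]
    have := odds_step (p := 1 / 2 + δ) (q := 1 / 2 - δ) (by linarith) (by linarith) (by ring)
      (integral_nonneg fun X => hge _)
      (integral_mono Integrable.of_finite Integrable.of_finite fun X => hmono
        (by
          intro v
          by_cases hv : v = w
          · subst hv
            simp
          · simp [hv] :
          Function.update X w false ≤ Function.update X w true))
      (by
        calc ∫ X, f (Function.update X w true) ∂signalMeasure V δ
            ≤ ∫ X, (1 : ℝ) ∂signalMeasure V δ :=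
              integral_mono Integrable.of_finite Integrable.of_finite fun X => hle _
          _ = 1 := by simp) i₀ i₁
    simp only [Function.comp_apply] at this
    convert this using 2 <;> ring

/-- An announcement rule that is monotone in the signals and commutes with exchanging the two
opinions is correct at least as often as a single signal. -/
lemma integral_ge_of_monotone_of_selfDual (h₀ : 0 ≤ δ) (h₁ : δ < 1 / 2) {f : (V → Bool) → ℝ}
    (hmono : Monotone f) (hf01 : ∀ X, f X = 0 ∨ f X = 1)
    (hdual : ∀ X, f (fun v => !X v) = 1 - f X) :
    1 / 2 + δ ≤ ∫ X, f X ∂signalMeasure V δ := by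
  have := isProbabilityMeasure_signalLaw (δ := δ) (by linarith) h₁.le
  have h := integral_odds_le h₀ h₁ Finset.univ f hmono hf01 (by simpa using dependsOn_univ f)
  rw [← integral_comp_not (by linarith) h₁.le] at h
  simp only [hdual] at h
  rw [integral_sub Integrable.of_finite Integrable.of_finite, integral_const, probReal_univ] at h
  set a := ∫ X, f X ∂signalMeasure V δ
  have ha : 0 ≤ a := integral_nonneg fun X => by rcases hf01 X with h | h <;> simp [h]
  simp only [smul_eq_mul, mul_one] at h
  have h2 : ((1 - a) * (1 / 2 + δ)) ^ 2 ≤ (a * (1 / 2 - δ)) ^ 2 := by nlinarith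
  have h3 := abs_le_of_sq_le_sq h2 (mul_nonneg ha (by linarith))
  linarith [le_abs_self ((1 - a) * (1 / 2 + δ))]

end Signals

/-! ### Majority dynamics with some announcements prescribed -/

section Dynamics

variable {V : Type u} [Fintype V] {G : SimpleGraph V} {X X' : V → Bool} {s : ℕ → V}

/-- The sign of an announcement: `1` for Correct, `-1` for Incorrect and `0` for none. It orders
the announcements as Incorrect `<` none `<` Correct. -/
def opinion : Option Bool → ℤ
  | none => 0
  | some true => 1
  | some false => -1

/-- The indicator of a Correct announcement. -/
noncomputable def correctness (b : Option Bool) : ℝ :=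
  if b = some true then 1 else 0

lemma correctness_eq_zero_or_one (b : Option Bool) : correctness b = 0 ∨ correctness b = 1 := by
  rw [correctness]
  split_ifs <;> simp

lemma correctness_nonneg (b : Option Bool) : 0 ≤ correctness b := by
  rcases correctness_eq_zero_or_one b with h | h <;> simp [h]

lemma correctness_le_one (b : Option Bool) : correctness b ≤ 1 := by
  rcases correctness_eq_zero_or_one b with h | h <;> simp [h]

lemma opinion_map_not (b : Option Bool) : opinion (b.map not) = -opinion b := by
  rcases b with _ | _ | _ <;> simp [opinion]

open Classical in
/-- The number of Correct minus the number of Incorrect announcements among the neighbors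
of `v`. -/
noncomputable def tally (G : SimpleGraph V) (C : V → Option Bool) (v : V) : ℤ :=
  ∑ w with G.Adj v w, opinion (C w)

lemma nbrCount_sub_nbrCount (C : V → Option Bool) (v : V) :
    (nbrCount G C true v : ℤ) - nbrCount G C false v = tally G C v := by
  classical
  simp only [nbrCount, tally, Finset.card_filter, Nat.cast_sum, ← Finset.sum_sub_distrib,
    Finset.sum_filter]
  refine Finset.sum_congr rfl fun w _ => ?_
  by_cases h : G.Adj v w
  · rcases C w with _ | _ | _ <;> simp [h, opinion]
  · simp [h]

lemma majorityVote_eq_true_iff {C : V → Option Bool} {v : V} :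
    majorityVote G X C v = true ↔ 0 < tally G C v ∨ (tally G C v = 0 ∧ X v = true) := by
  rw [← nbrCount_sub_nbrCount, majorityVote]
  split_ifs with h1 h2
  · simp [h1]
  · simp only [false_iff]
    omega
  · have : nbrCount G C true v = nbrCount G C false v := by omega
    simp [this]

lemma majorityVote_eq_true_of_le {C C' : V → Option Bool} {v : V}
    (hC : ∀ w, opinion (C w) ≤ opinion (C' w)) (hX : X ≤ X') (h : majorityVote G X C v = true) :
    majorityVote G X' C' v = true := by
  rw [majorityVote_eq_true_iff] at h ⊢
  have ht : tally G C v ≤ tally G C' v := Finset.sum_le_sum fun w _ => hC w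
  have hv := hX v
  rcases h with h | ⟨h, hx⟩
  · left
    omega
  · rw [hx] at hv
    rcases ht.lt_or_eq with h' | h'
    · left
      omega
    · right
      exact ⟨by omega, top_le_iff.1 hv⟩

lemma majorityVote_not (C : V → Option Bool) (v : V) :
    majorityVote G (fun v => !X v) (fun w => (C w).map not) v = !majorityVote G X C v := by
  have ht : tally G (fun w => (C w).map not) v = -tally G C v := by
    simp [tally, opinion_map_not]
  have h := majorityVote_eq_true_iff (G := G) (X := X) (C := C) (v := v)
  rw [Bool.eq_iff_iff, majorityVote_eq_true_iff, ht]
  cases hX : X v <;> cases hv : majorityVote G X C v <;>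
    simp only [hX, hv, Bool.not_true, Bool.not_false, and_true, and_false, or_false,
      true_iff, false_iff, reduceCtorEq, iff_true, iff_false] at h ⊢ <;> omega

lemma majorityVote_congr {C C' : V → Option Bool} {v : V}
    (hC : ∀ w, G.Adj v w → C w = C' w) (hX : X v = X' v) :
    majorityVote G X C v = majorityVote G X' C' v := by
  have ht : tally G C v = tally G C' v :=
    Finset.sum_congr rfl fun w hw => by rw [hC w (by simpa using hw)]
  rw [Bool.eq_iff_iff, majorityVote_eq_true_iff, majorityVote_eq_true_iff, ht, hX]

open Classical in
/-- The announcements in the modified dynamics in which the nodes of `W` announce `b` whenever they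
are selected, while all other nodes follow the majority rule. With `b = none` the nodes of `W` are
silent for ever. -/
noncomputable def forcedAnnouncement (G : SimpleGraph V) (X : V → Bool) (s : ℕ → V) (W : Set V)
    (b : Option Bool) : ℕ → V → Option Bool
  | 0 => fun _ => none
  | t + 1 => fun v =>
      if v = s t then
        if v ∈ W then b else some (majorityVote G X (forcedAnnouncement G X s W b t) v)
      else forcedAnnouncement G X s W b t v

lemma forcedAnnouncement_empty (b : Option Bool) (t : ℕ) :
    forcedAnnouncement G X s ∅ b t = announcement G X s t := by
  induction t with
  | zero => rfl
  | succ t ih =>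
    funext v
    simp [forcedAnnouncement, announcement, ih]

lemma forcedAnnouncement_mono (hX : X ≤ X') {W : Set V} {b b' : Option Bool}
    (hb : opinion b ≤ opinion b') (t : ℕ) (v : V) :
    opinion (forcedAnnouncement G X s W b t v) ≤ opinion (forcedAnnouncement G X' s W b' t v) := by
  induction t generalizing v with
  | zero => simp [forcedAnnouncement]
  | succ t ih =>
    simp only [forcedAnnouncement]
    split_ifs
    · exact hb
    · have := majorityVote_eq_true_of_le (G := G) (v := v) ih hX
      revert this
      generalize majorityVote G X _ v = c
      generalize majorityVote G X' _ v = c'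
      cases c <;> cases c' <;> simp [opinion]
    · exact ih v

lemma forcedAnnouncement_not (W : Set V) (t : ℕ) (v : V) :
    forcedAnnouncement G (fun v => !X v) s W none t v =
      (forcedAnnouncement G X s W none t v).map not := by
  induction t generalizing v with
  | zero => simp [forcedAnnouncement]
  | succ t ih =>
    simp only [forcedAnnouncement]
    split_ifs
    · simp
    · rw [show forcedAnnouncement G (fun v => !X v) s W none t =
        fun w => (forcedAnnouncement G X s W none t w).map not from funext ih, majorityVote_not]
      simp
    · exact ih v

lemma forcedAnnouncement_eq_none_iff {W : Set V} {b : Option Bool} {v : V} (hv : v ∉ W) (t : ℕ) :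
    forcedAnnouncement G X s W b t v = none ↔ ∀ k < t, s k ≠ v := by
  induction t with
  | zero => simp [forcedAnnouncement]
  | succ t ih =>
    simp only [forcedAnnouncement]
    split_ifs with h
    · simp only [false_iff, not_forall]
      exact ⟨t, by omega, by simp [h]⟩
    · rw [ih]
      constructor
      · intro h' k hk
        rcases Nat.lt_succ_iff_lt_or_eq.mp hk with hk | rfl
        · exact h' k hk
        · exact fun e => h e.symm
      · exact fun h' k hk => h' k (by omega)

/-- Prescribed announcements shield: if every edge leaving `S` ends in `W`, then the announcements
in `S` depend on the signals in `S` only. -/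
lemma dependsOn_forcedAnnouncement {S W : Set V} (hS : ∀ x ∈ S, ∀ y, G.Adj x y → y ∈ S ∨ y ∈ W)
    (b : Option Bool) (t : ℕ) {v : V} (hv : v ∈ S) :
    DependsOn (fun X => forcedAnnouncement G X s W b t v) S := by
  intro X Y hXY
  suffices H : ∀ t, ∀ v, v ∈ S ∨ v ∈ W →
      forcedAnnouncement G X s W b t v = forcedAnnouncement G Y s W b t v from H t v (Or.inl hv)
  clear v hv t
  intro t
  induction t with
  | zero => simp [forcedAnnouncement]
  | succ t ih =>
    intro v hv
    simp only [forcedAnnouncement]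
    split_ifs with h h'
    · rfl
    · have hvS : v ∈ S := by simpa [h'] using hv
      rw [majorityVote_congr (fun w hw => ih w (hS v hvS w hw)) (hXY v hvS)]
    · exact ih v hv

/-- As long as the majority rule makes `w` Correct anyway, pinning `w` to Correct changes
nothing. -/
lemma forcedAnnouncement_eq_announcement {w : V} {t : ℕ}
    (h : ∀ k < t, s k = w →
      majorityVote G X (forcedAnnouncement G X s {w} (some true) k) w = true) :
    forcedAnnouncement G X s {w} (some true) t = announcement G X s t := by
  induction t with
  | zero => rfl
  | succ t ih =>
    have e := ih fun k hk => h k (by omega)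
    funext v
    simp only [forcedAnnouncement, announcement]
    split_ifs with h1 h2
    · have := h t (by omega) (h1 ▸ h2)
      rw [Set.mem_singleton_iff] at h2
      rw [e] at this
      rw [h2, this]
    · rw [e]
    · rw [e]

/-- The signals on which the announcement of `v` depends travel to `v` along walks whose vertices
are selected in this order. -/
lemma dependsOn_announcement (t : ℕ) (v : V) :
    DependsOn (fun X => announcement G X s t v)
      {x | ∃ p : G.Walk x v, p.support.Sublist ((List.range t).map s)} := by
  intro X Y hXY
  induction t generalizing v with
  | zero => simp [announcement]
  | succ t ih =>
    simp only [announcement]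
    have hL : (List.range (t + 1)).map s = (List.range t).map s ++ [s t] := by
      simp [List.range_succ]
    rw [hL] at hXY
    split_ifs with h
    · congr 1
      refine majorityVote_congr (fun y hy => ih y fun x ⟨p, hp⟩ => hXY x ?_) (hXY v ?_)
      · refine ⟨p.concat hy.symm, ?_⟩
        rw [SimpleGraph.Walk.support_concat, h]
        exact hp.append (List.Sublist.refl _)
      · exact ⟨SimpleGraph.Walk.nil, by simp [h]⟩
    · exact ih v fun x ⟨p, hp⟩ => hXY x ⟨p, hp.trans (List.sublist_append_left _ _)⟩

end Dynamics

/-! ### Each announcement is Correct at least as often as a signal -/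

section Mean

variable {V : Type u} [Fintype V] {G : SimpleGraph V} {s : ℕ → V} {δ : ℝ}

lemma integral_forcedAnnouncement_ge (h₀ : 0 ≤ δ) (h₁ : δ < 1 / 2) {W : Set V} {v : V} (hv : v ∉ W)
    {t : ℕ} (hsel : ∃ k < t, s k = v) :
    1 / 2 + δ ≤ ∫ X, correctness (forcedAnnouncement G X s W none t v) ∂signalMeasure V δ := by
  have hne : ∀ X, forcedAnnouncement G X s W none t v ≠ none := fun X h => by
    obtain ⟨k, hk, e⟩ := hsel
    exact (forcedAnnouncement_eq_none_iff hv t).1 h k hk e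
  refine integral_ge_of_monotone_of_selfDual h₀ h₁ ?_ ?_ ?_
  · intro X Y hXY
    have := forcedAnnouncement_mono (G := G) (s := s) (W := W) (b := none) hXY le_rfl t v
    revert this
    dsimp only
    generalize forcedAnnouncement G X s W none t v = c
    generalize forcedAnnouncement G Y s W none t v = c'
    rcases c with _ | _ | _ <;> rcases c' with _ | _ | _ <;>
      simp [opinion, correctness]
  · exact fun X => correctness_eq_zero_or_one _
  · intro X
    have := hne X
    rw [forcedAnnouncement_not]
    revert this
    generalize forcedAnnouncement G X s W none t v = c
    rcases c with _ | _ | _ <;> simp [correctness]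

end Mean

/-! ### The parts of a tree on either side of a node -/

section Side

variable {V : Type u} {G : SimpleGraph V}

/-- The nodes from which `x` can be reached without passing through `w`. -/
def side (G : SimpleGraph V) (w x : V) : Set V :=
  {y | ∃ p : G.Walk y x, w ∉ p.support}

lemma mem_side_self {w x : V} (h : x ≠ w) : x ∈ side G w x :=
  ⟨SimpleGraph.Walk.nil, by simpa using h.symm⟩

lemma mem_side_or_of_adj {w x y z : V} (hy : y ∈ side G w x) (hyz : G.Adj y z) :
    z ∈ side G w x ∨ z ∈ ({w} : Set V) := by
  by_cases hz : z = w
  · exact Or.inr hz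
  · obtain ⟨p, hp⟩ := hy
    exact Or.inl ⟨SimpleGraph.Walk.cons hyz.symm p, by simp [hp, Ne.symm hz]⟩

lemma disjoint_side {w x x' : V} (h : ∀ p : G.Walk x x', w ∈ p.support) :
    Disjoint (side G w x) (side G w x') := by
  rw [Set.disjoint_left]
  rintro y ⟨p, hp⟩ ⟨q, hq⟩
  have := h (p.reverse.append q)
  rw [SimpleGraph.Walk.mem_support_append_iff, SimpleGraph.Walk.support_reverse,
    List.mem_reverse] at this
  exact this.elim hp hq

lemma support_sublist_of_isPath (hG : G.IsTree) {u v : V} {p : G.Walk u v} (hp : p.IsPath)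
    (q : G.Walk u v) : p.support.Sublist q.support := by
  classical
  have : q.bypass = p := (hG.existsUnique_path u v).unique q.bypass_isPath hp
  rw [← this]
  exact q.support_bypass_sublist_support

lemma disjoint_side_of_adj (hG : G.IsTree) {w x x' : V} (hx : G.Adj w x) (hx' : G.Adj w x')
    (hne : x ≠ x') : Disjoint (side G w x) (side G w x') := by
  refine disjoint_side fun q => ?_
  have hp : (SimpleGraph.Walk.cons hx.symm (SimpleGraph.Walk.cons hx' .nil)).IsPath := by
    simp [hx.ne', hx'.ne, hne]
  exact (support_sublist_of_isPath hG hp q).subset (by simp)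

end Side

/-! ### A node that has heard enough neighbors is Correct -/

section Chernoff

variable {V : Type u} [Fintype V] {G : SimpleGraph V} {s : ℕ → V} {δ : ℝ}

lemma two_mul_sqrt_mul_sqrt_le (h₀ : 0 < δ) (h₁ : δ < 1 / 2) :
    2 * (√(1 / 2 + δ) * √(1 / 2 - δ)) ≤ Real.exp (-(2 * δ ^ 2)) := by
  have h : (2 * (√(1 / 2 + δ) * √(1 / 2 - δ))) ^ 2 ≤ Real.exp (-(2 * δ ^ 2)) ^ 2 := by
    rw [mul_pow, mul_pow, Real.sq_sqrt (by linarith), Real.sq_sqrt (by linarith),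
      ← Real.exp_nat_mul]
    have := Real.add_one_le_exp (((2 : ℕ) : ℝ) * -(2 * δ ^ 2))
    push_cast at this ⊢
    nlinarith
  exact le_of_sq_le_sq h (Real.exp_pos _).le

open Classical in
/-- The Chernoff bound at a node `w` that has always been Correct so far: its neighbors do at least
as well as if `w` were silent, and then they are independent because they lie in different
components of the tree without `w`. -/
lemma integral_majorityVote_ne_true_le (hG : G.IsTree) (h₀ : 0 < δ) (h₁ : δ < 1 / 2) (w : V)
    (t M : ℕ)
    (hM : M ≤ (Finset.univ.filter fun x => G.Adj w x ∧ ∃ k < t, s k = x).card) :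
    ∫ X, (if majorityVote G X (forcedAnnouncement G X s {w} (some true) t) w = true
        then 0 else 1 : ℝ) ∂signalMeasure V δ ≤ Real.exp (-(2 * δ ^ 2 * M)) := by
  have hprob := isProbabilityMeasure_signalLaw (δ := δ) (by linarith) h₁.le
  set θ := √(1 / 2 + δ) / √(1 / 2 - δ) with hθ
  have hsq : 0 < √(1 / 2 - δ) := Real.sqrt_pos.2 (by linarith)
  have hsp : 0 < √(1 / 2 + δ) := Real.sqrt_pos.2 (by linarith)
  have hθ1 : 1 ≤ θ := by
    rw [hθ, one_le_div hsq]
    exact Real.sqrt_le_sqrt (by linarith)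
  have hθ0 : 0 < θ := by linarith
  set N := Finset.univ.filter fun x => G.Adj w x with hN
  set g : V → (V → Bool) → ℝ := fun x X =>
    θ ^ (-opinion (forcedAnnouncement G X s {w} none t x)) with hg
  have hpt : ∀ X, (if majorityVote G X (forcedAnnouncement G X s {w} (some true) t) w = true
      then 0 else 1 : ℝ) ≤ ∏ x ∈ N, g x X := by
    intro X
    have hprod : ∏ x ∈ N, g x X = θ ^ (-tally G (forcedAnnouncement G X s {w} none t) w) := by
      rw [tally, ← Finset.sum_neg_distrib]
      simp only [hg, hN]
      induction (Finset.univ.filter fun x => G.Adj w x) using Finset.induction_on with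
      | empty => simp
      | insert a I ha ih => rw [Finset.prod_insert ha, Finset.sum_insert ha, ih, zpow_add₀ hθ0.ne']
    rw [hprod]
    split_ifs with h
    · positivity
    · refine one_le_zpow₀ hθ1 ?_
      rw [majorityVote_eq_true_iff] at h
      have hle : tally G (forcedAnnouncement G X s {w} none t) w ≤
          tally G (forcedAnnouncement G X s {w} (some true) t) w :=
        Finset.sum_le_sum fun x _ => forcedAnnouncement_mono le_rfl (by simp [opinion]) t x
      omega
  have hdep : ∀ x ∈ N, DependsOn (g x) (side G w x) := by
    intro x hx X Y h
    have hadj : G.Adj w x := by simpa [hN] using hx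
    have := dependsOn_forcedAnnouncement (G := G) (s := s) (W := {w})
      (fun y hy z hyz => mem_side_or_of_adj hy hyz) none t (mem_side_self hadj.ne') h
    simp only at this
    simp [hg, this]
  have hdisj : (N : Set V).PairwiseDisjoint (side G w) := by
    intro x hx y hy hne
    exact disjoint_side_of_adj hG (by simpa [hN] using hx) (by simpa [hN] using hy) hne
  have hfac : ∀ x ∈ N, ∫ X, g x X ∂signalMeasure V δ ≤
      if ∃ k < t, s k = x then Real.exp (-(2 * δ ^ 2)) else 1 := by
    intro x hx
    have hadj : G.Adj w x := by simpa [hN] using hx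
    have hxw : x ∉ ({w} : Set V) := by simpa using hadj.ne'
    split_ifs with hsel
    · have hform : ∀ X, g x X =
          θ - (θ - θ⁻¹) * correctness (forcedAnnouncement G X s {w} none t x) := by
        intro X
        have hne : forcedAnnouncement G X s {w} none t x ≠ none := fun h => by
          obtain ⟨k, hk, e⟩ := hsel
          exact (forcedAnnouncement_eq_none_iff hxw t).1 h k hk e
        simp only [hg]
        revert hne
        generalize forcedAnnouncement G X s {w} none t x = c
        rcases c with _ | _ | _ <;> simp [opinion, correctness]
      have hmean := integral_forcedAnnouncement_ge (G := G) h₀.le h₁ hxw hsel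
      have hinv : θ⁻¹ ≤ θ := (inv_le_one_of_one_le₀ hθ1).trans hθ1
      calc ∫ X, g x X ∂signalMeasure V δ
          = θ - (θ - θ⁻¹) *
            ∫ X, correctness (forcedAnnouncement G X s {w} none t x) ∂signalMeasure V δ := by
            simp only [hform]
            rw [integral_sub Integrable.of_finite Integrable.of_finite, integral_const_mul]
            simp
        _ ≤ θ - (θ - θ⁻¹) * (1 / 2 + δ) := by
            have : 0 ≤ θ - θ⁻¹ := by linarith
            gcongr
        _ = θ * (1 / 2 - δ) + θ⁻¹ * (1 / 2 + δ) := by ring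
        _ = 2 * (√(1 / 2 + δ) * √(1 / 2 - δ)) := by
            have e1 : √(1 / 2 + δ) * √(1 / 2 + δ) = 1 / 2 + δ := Real.mul_self_sqrt (by linarith)
            have e2 : √(1 / 2 - δ) * √(1 / 2 - δ) = 1 / 2 - δ := Real.mul_self_sqrt (by linarith)
            have d1 : θ * √(1 / 2 - δ) = √(1 / 2 + δ) := div_mul_cancel₀ _ hsq.ne'
            have d2 : θ⁻¹ * √(1 / 2 + δ) = √(1 / 2 - δ) := by
              rw [← d1, inv_mul_cancel_left₀ hθ0.ne']
            have f1 : θ * (1 / 2 - δ) = √(1 / 2 + δ) * √(1 / 2 - δ) := by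
              linear_combination √(1 / 2 - δ) * d1 - θ * e2
            have f2 : θ⁻¹ * (1 / 2 + δ) = √(1 / 2 + δ) * √(1 / 2 - δ) := by
              linear_combination √(1 / 2 + δ) * d2 - θ⁻¹ * e1
            rw [f1, f2]
            ring
        _ ≤ _ := two_mul_sqrt_mul_sqrt_le h₀ h₁
    · have hone : ∀ X, g x X = 1 := by
        intro X
        have : forcedAnnouncement G X s {w} none t x = none := by
          rw [forcedAnnouncement_eq_none_iff hxw]
          push Not at hsel
          exact hsel
        simp [hg, this, opinion]
      simp [hone]
  calc _ ≤ ∫ X, ∏ x ∈ N, g x X ∂signalMeasure V δ :=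
        integral_mono Integrable.of_finite Integrable.of_finite hpt
    _ = ∏ x ∈ N, ∫ X, g x X ∂signalMeasure V δ := integral_prod_of_dependsOn N hdep hdisj
    _ ≤ ∏ x ∈ N, if ∃ k < t, s k = x then Real.exp (-(2 * δ ^ 2)) else 1 :=
        Finset.prod_le_prod
          (fun x _ => integral_nonneg fun X => by positivity) hfac
    _ = Real.exp (-(2 * δ ^ 2)) ^
          (Finset.univ.filter fun x => G.Adj w x ∧ ∃ k < t, s k = x).card := by
        rw [Finset.prod_ite, Finset.prod_const, Finset.prod_const_one, mul_one, hN,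
          Finset.filter_filter]
    _ ≤ Real.exp (-(2 * δ ^ 2)) ^ M :=
        pow_le_pow_of_le_one (Real.exp_pos _).le (Real.exp_le_one_iff.2 (by nlinarith)) hM
    _ = Real.exp (-(2 * δ ^ 2 * M)) := by
        rw [← Real.exp_nat_mul]
        congr 1
        ring

end Chernoff

/-! ### Covariances for a fixed schedule -/

section Covariance

variable {V : Type u} [Fintype V] {G : SimpleGraph V} {s : ℕ → V} {δ : ℝ}

/-- The covariance, over the signals, of the events that `u` and that `v` announce Correct after
`T` steps of the schedule `s`. -/
noncomputable def correctnessCov (G : SimpleGraph V) (δ : ℝ) (s : ℕ → V) (T : ℕ) (u v : V) : ℝ :=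
  cov[fun X => correctness (announcement G X s T u), fun X => correctness (announcement G X s T v);
    signalMeasure V δ]

lemma correctnessCov_eq [IsProbabilityMeasure (signalLaw δ)] (T : ℕ) (u v : V) :
    correctnessCov G δ s T u v =
      (∫ X, correctness (announcement G X s T u) * correctness (announcement G X s T v)
        ∂signalMeasure V δ) -
      (∫ X, correctness (announcement G X s T u) ∂signalMeasure V δ) *
        ∫ X, correctness (announcement G X s T v) ∂signalMeasure V δ :=
  covariance_eq_sub MemLp.of_discrete MemLp.of_discrete

lemma integral_correctness_nonneg (c : (V → Bool) → Option Bool) :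
    0 ≤ ∫ X, correctness (c X) ∂signalMeasure V δ :=
  integral_nonneg fun _ => correctness_nonneg _

lemma integral_correctness_le_one [IsProbabilityMeasure (signalLaw δ)]
    (c : (V → Bool) → Option Bool) : ∫ X, correctness (c X) ∂signalMeasure V δ ≤ 1 := by
  calc ∫ X, correctness (c X) ∂signalMeasure V δ ≤ ∫ _, (1 : ℝ) ∂signalMeasure V δ :=
        integral_mono Integrable.of_finite Integrable.of_finite fun X => correctness_le_one _
    _ = 1 := by simp

lemma correctnessCov_le_one [IsProbabilityMeasure (signalLaw δ)] (T : ℕ) (u v : V) :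
    correctnessCov G δ s T u v ≤ 1 := by
  rw [correctnessCov_eq]
  have h1 : ∫ X, correctness (announcement G X s T u) * correctness (announcement G X s T v)
      ∂signalMeasure V δ ≤ ∫ _, (1 : ℝ) ∂signalMeasure V δ :=
    integral_mono Integrable.of_finite Integrable.of_finite fun X =>
      mul_le_one₀ (correctness_le_one _) (correctness_nonneg _) (correctness_le_one _)
  have h2 := mul_nonneg
    (integral_correctness_nonneg (δ := δ) fun X => announcement G X s T u)
    (integral_correctness_nonneg (δ := δ) fun X => announcement G X s T v)
  simp only [integral_const, probReal_univ, smul_eq_mul, mul_one] at h1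
  linarith

/-- If no signal can travel to both `u` and `v`, their announcements are uncorrelated. -/
lemma correctnessCov_eq_zero [IsProbabilityMeasure (signalLaw δ)] {T : ℕ} {u v : V}
    (h : ∀ (x : V) (p : G.Walk x u) (q : G.Walk x v),
      p.support.Sublist ((List.range T).map s) → ¬ q.support.Sublist ((List.range T).map s)) :
    correctnessCov G δ s T u v = 0 := by
  rw [correctnessCov_eq, sub_eq_zero]
  refine integral_mul_of_dependsOn
    (fun X Y hXY => congrArg correctness (dependsOn_announcement T u hXY))
    (fun X Y hXY => congrArg correctness (dependsOn_announcement T v hXY)) ?_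
  rw [Set.disjoint_left]
  rintro x ⟨p, hp⟩ ⟨q, hq⟩
  exact h x p q hp hq

open Classical in
/-- If some node `w` separating `u` from `v` is only ever selected after `M` of its neighbors, then
`w` is always Correct up to a small probability, and the announcements of `u` and `v` are
independent in the dynamics in which `w` is pinned to Correct. -/
lemma correctnessCov_le (hG : G.IsTree) (h₀ : 0 < δ) (h₁ : δ < 1 / 2) {T M : ℕ} {u v w : V}
    (hu : u ≠ w) (hv : v ≠ w) (huv : ∀ p : G.Walk u v, w ∈ p.support)
    (hM : ∀ k < T, s k = w →
      M ≤ (Finset.univ.filter fun x => G.Adj w x ∧ ∃ j < k, s j = x).card) :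
    correctnessCov G δ s T u v ≤ 3 * (T * Real.exp (-(2 * δ ^ 2 * M))) := by
  have hprob := isProbabilityMeasure_signalLaw (δ := δ) (by linarith) h₁.le
  rw [correctnessCov_eq]
  set f : V → (V → Bool) → ℝ := fun x X => correctness (announcement G X s T x) with hf
  set f' : V → (V → Bool) → ℝ := fun x X =>
    correctness (forcedAnnouncement G X s {w} (some true) T x) with hf'
  set b : ℕ → (V → Bool) → ℝ := fun k X =>
    if majorityVote G X (forcedAnnouncement G X s {w} (some true) k) w = true
      then 0 else 1 with hb
  set K := (Finset.range T).filter fun k => s k = w with hK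
  set B : (V → Bool) → ℝ := fun X => ∑ k ∈ K, b k X with hB
  have hb0 : ∀ k X, 0 ≤ b k X := fun k X => by
    simp only [hb]
    split_ifs <;> simp
  have hB0 : ∀ X, 0 ≤ B X := fun X => Finset.sum_nonneg fun k _ => hb0 k X
  have hcase : ∀ X, (∀ x, f x X = f' x X) ∨ 1 ≤ B X := by
    intro X
    by_cases h : ∀ k < T, s k = w →
        majorityVote G X (forcedAnnouncement G X s {w} (some true) k) w = true
    · left
      intro x
      simp only [hf, hf']
      rw [forcedAnnouncement_eq_announcement h]
    · right
      push Not at h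
      obtain ⟨k, hk, hkw, hne⟩ := h
      calc (1 : ℝ) = b k X := by simp [hb, hne]
        _ ≤ B X := Finset.single_le_sum (f := fun k => b k X) (fun k _ => hb0 k X)
            (by simp [hK, hk, hkw])
  have hEB : ∫ X, B X ∂signalMeasure V δ ≤ T * Real.exp (-(2 * δ ^ 2 * M)) := by
    calc ∫ X, B X ∂signalMeasure V δ = ∑ k ∈ K, ∫ X, b k X ∂signalMeasure V δ :=
          integral_finsetSum _ fun _ _ => Integrable.of_finite
      _ ≤ ∑ _k ∈ K, Real.exp (-(2 * δ ^ 2 * M)) := by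
          refine Finset.sum_le_sum fun k hk => ?_
          simp only [hK, Finset.mem_filter, Finset.mem_range] at hk
          exact integral_majorityVote_ne_true_le hG h₀ h₁ w k M (hM k hk.1 hk.2)
      _ = K.card * Real.exp (-(2 * δ ^ 2 * M)) := by simp
      _ ≤ T * Real.exp (-(2 * δ ^ 2 * M)) := by
          have : K.card ≤ T := (Finset.card_filter_le _ _).trans (by simp)
          gcongr
  have hf0 : ∀ x X, 0 ≤ f x X := fun x X => correctness_nonneg _
  have hf1 : ∀ x X, f x X ≤ 1 := fun x X => correctness_le_one _
  have hf0' : ∀ x X, 0 ≤ f' x X := fun x X => correctness_nonneg _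
  have hf1' : ∀ x X, f' x X ≤ 1 := fun x X => correctness_le_one _
  have hind : ∫ X, f' u X * f' v X ∂signalMeasure V δ =
      (∫ X, f' u X ∂signalMeasure V δ) * ∫ X, f' v X ∂signalMeasure V δ := by
    have hd : ∀ x, x ≠ w → DependsOn (f' x) (side G w x) := fun x hx X Y hXY =>
      congrArg correctness (dependsOn_forcedAnnouncement (W := {w})
        (fun y hy z hyz => mem_side_or_of_adj hy hyz) (some true) T (mem_side_self hx) hXY)
    exact integral_mul_of_dependsOn (hd u hu) (hd v hv) (disjoint_side huv)
  have e1 : ∫ X, f u X * f v X ∂signalMeasure V δ ≤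
      (∫ X, f' u X * f' v X ∂signalMeasure V δ) + ∫ X, B X ∂signalMeasure V δ := by
    rw [← integral_add Integrable.of_finite Integrable.of_finite]
    refine integral_mono Integrable.of_finite Integrable.of_finite fun X => ?_
    dsimp only
    rcases hcase X with h | h
    · rw [h, h]
      linarith [hB0 X]
    · have := mul_le_one₀ (hf1 u X) (hf0 v X) (hf1 v X)
      have := mul_nonneg (hf0' u X) (hf0' v X)
      linarith
  have e2 : ∀ x, (∫ X, f' x X ∂signalMeasure V δ) - ∫ X, B X ∂signalMeasure V δ ≤
      ∫ X, f x X ∂signalMeasure V δ := by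
    intro x
    rw [← integral_sub Integrable.of_finite Integrable.of_finite]
    refine integral_mono Integrable.of_finite Integrable.of_finite fun X => ?_
    dsimp only
    rcases hcase X with h | h
    · rw [h]
      linarith [hB0 X]
    · linarith [hf0 x X, hf1' x X]
  have a0 : 0 ≤ ∫ X, f u X ∂signalMeasure V δ := integral_correctness_nonneg _
  have a1 : ∫ X, f u X ∂signalMeasure V δ ≤ 1 := integral_correctness_le_one _
  have b0 : 0 ≤ ∫ X, f' v X ∂signalMeasure V δ := integral_correctness_nonneg _
  have b1 : ∫ X, f' v X ∂signalMeasure V δ ≤ 1 := integral_correctness_le_one _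
  have eB : 0 ≤ ∫ X, B X ∂signalMeasure V δ := integral_nonneg hB0
  have := e2 u
  have := e2 v
  change (∫ X, f u X * f v X ∂signalMeasure V δ) -
    (∫ X, f u X ∂signalMeasure V δ) * ∫ X, f v X ∂signalMeasure V δ ≤ _
  nlinarith

end Covariance

/-! ### The random schedule -/

section Schedule

variable {V : Type u} [Fintype V] [MeasurableSpace V] [DiscreteMeasurableSpace V]

/-- The law of the sequence of selected nodes. -/
noncomputable abbrev scheduleMeasure (V : Type u) [Fintype V] [MeasurableSpace V] :
    Measure (ℕ → V) :=
  Measure.infinitePi fun _ : ℕ => uniformOn (Set.univ : Set V)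

instance isProbabilityMeasure_uniformOn_univ [Nonempty V] :
    IsProbabilityMeasure (uniformOn (Set.univ : Set V)) :=
  isProbabilityMeasure_uniformOn Set.finite_univ Set.univ_nonempty

lemma measurableSet_prod_of_forall_lt {T : ℕ} {A : Set ((V → Bool) × (ℕ → V))}
    (hA : ∀ X s s', (∀ k < T, s k = s' k) → (X, s) ∈ A → (X, s') ∈ A) : MeasurableSet A := by
  set r : (V → Bool) × (ℕ → V) → (V → Bool) × (Fin T → V) :=
    fun ω => (ω.1, fun k => ω.2 k) with hr
  have hm : Measurable r := by fun_prop
  have : A = r ⁻¹' (r '' A) := by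
    refine Set.Subset.antisymm (Set.subset_preimage_image _ _) ?_
    rintro ⟨X, s'⟩ ⟨⟨X', s⟩, hs, he⟩
    simp only [hr, Prod.mk.injEq] at he
    obtain ⟨rfl, he⟩ := he
    exact hA _ s s' (fun k hk => congrFun he ⟨k, hk⟩) hs
  rw [this]
  exact hm (Set.toFinite _).measurableSet

lemma measurableSet_of_forall_lt {T : ℕ} {A : Set (ℕ → V)}
    (hA : ∀ s s', (∀ k < T, s k = s' k) → s ∈ A → s' ∈ A) : MeasurableSet A := by
  set r : (ℕ → V) → (Fin T → V) := fun s k => s k with hr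
  have hm : Measurable r := by fun_prop
  have : A = r ⁻¹' (r '' A) := by
    refine Set.Subset.antisymm (Set.subset_preimage_image _ _) ?_
    rintro s' ⟨s, hs, he⟩
    exact hA s s' (fun k hk => congrFun he ⟨k, hk⟩) hs
  rw [this]
  exact hm (Set.toFinite _).measurableSet

lemma uniformOn_univ_real (F : Finset V) :
    (uniformOn (Set.univ : Set V)).real F = (F.card : ℝ) / Fintype.card V := by
  rw [measureReal_def, uniformOn_univ, Measure.count_apply_finset, ENNReal.toReal_div]
  simp

lemma map_uniformOn_univ_perm (σ : Equiv.Perm V) :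
    (uniformOn (Set.univ : Set V)).map σ = uniformOn Set.univ := by
  refine Measure.ext_of_singleton fun a => ?_
  rw [Measure.map_apply (measurable_of_finite _) (measurableSet_singleton a),
    uniformOn_univ, uniformOn_univ]
  have : σ ⁻¹' {a} = {σ.symm a} := by
    ext x
    simp [Equiv.eq_symm_apply]
  rw [this]
  simp

lemma scheduleMeasure_real_perm [Nonempty V] (σ : Equiv.Perm V) {A : Set (ℕ → V)}
    (hA : MeasurableSet A) :
    (scheduleMeasure V).real {s | (fun k => σ (s k)) ∈ A} = (scheduleMeasure V).real A := by
  have h := Measure.infinitePi_map_pi (fun _ : ℕ => uniformOn (Set.univ : Set V))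
    (f := fun _ => σ) (fun _ => measurable_of_finite _)
  simp only [map_uniformOn_univ_perm] at h
  rw [measureReal_def, measureReal_def]
  congr 1
  conv_rhs => rw [scheduleMeasure, ← h]
  rw [Measure.map_apply (by
    refine measurable_pi_lambda _ fun k => ?_
    exact (measurable_of_finite σ).comp (measurable_pi_apply k)) hA]
  rfl

lemma scheduleMeasure_real_inter_eq [Nonempty V] {T : ℕ} {A : Set (ℕ → V)}
    (hA : ∀ s s', (∀ k < T, s k = s' k) → s ∈ A → s' ∈ A) (x : V) :
    (scheduleMeasure V).real (A ∩ {s | s T = x}) =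
      (scheduleMeasure V).real A * (1 / Fintype.card V) := by
  classical
  have hi : iIndepFun (fun (k : ℕ) (s : ℕ → V) => s k) (scheduleMeasure V) :=
    iIndepFun_infinitePi (X := fun _ x => x) fun _ => measurable_id
  have h2 := hi.indepFun_finset (Finset.range T) {T} (by simp)
    (fun i => measurable_pi_apply i)
  set r : (ℕ → V) → (Finset.range T → V) := fun s k => s k with hr
  have hAr : A = r ⁻¹' (r '' A) := by
    refine Set.Subset.antisymm (Set.subset_preimage_image _ _) ?_
    rintro s' ⟨s, hs, he⟩
    exact hA s s' (fun k hk => congrFun he ⟨k, by simpa using hk⟩) hs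
  have hx : {s : ℕ → V | s T = x} =
      (fun (s : ℕ → V) (i : ({T} : Finset ℕ)) => s i) ⁻¹' {y | y ⟨T, by simp⟩ = x} := rfl
  have h3 := h2.measure_inter_preimage_eq_mul (r '' A) {y | y ⟨T, by simp⟩ = x}
    (Set.toFinite _).measurableSet (Set.toFinite _).measurableSet
  rw [← hAr, ← hx] at h3
  have h4 : (scheduleMeasure V) {s | s T = x} = uniformOn (Set.univ : Set V) {x} := by
    rw [← Measure.infinitePi_map_eval (fun _ : ℕ => uniformOn (Set.univ : Set V)) T,
      Measure.map_apply (measurable_pi_apply T) (measurableSet_singleton x)]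
    rfl
  have h5 := uniformOn_univ_real ({x} : Finset V)
  rw [measureReal_def] at h5 ⊢
  rw [h3, h4, ENNReal.toReal_mul, measureReal_def]
  congr 1
  simpa using h5

/-- A given list of nodes is selected in order within `T` steps with probability at most
`T.choose k / n ^ k`, where `k` is its length. -/
lemma scheduleMeasure_real_sublist_le [Nonempty V] (T : ℕ) (l : List V) :
    (scheduleMeasure V).real {s | l.Sublist ((List.range T).map s)} ≤
      (T.choose l.length : ℝ) / (Fintype.card V : ℝ) ^ l.length := by
  have hdep : ∀ (T : ℕ) (l : List V) (s s' : ℕ → V), (∀ k < T, s k = s' k) →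
      l.Sublist ((List.range T).map s) → l.Sublist ((List.range T).map s') := by
    intro T l s s' h hl
    rwa [List.map_congr_left (g := s') fun k hk => h k (by simpa using hk)] at hl
  induction T generalizing l with
  | zero =>
    rcases l with _ | ⟨a, l⟩
    · simp
    · simp
  | succ T ih =>
    rcases List.eq_nil_or_concat l with rfl | ⟨l', x, rfl⟩
    · simp
    · simp only [List.concat_eq_append]
      have hsub : {s : ℕ → V | (l' ++ [x]).Sublist ((List.range (T + 1)).map s)} ⊆
          {s | (l' ++ [x]).Sublist ((List.range T).map s)} ∪
            ({s | l'.Sublist ((List.range T).map s)} ∩ {s | s T = x}) := by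
        intro s hs
        simp only [Set.mem_ofPred_eq, List.range_succ, List.map_append, List.map_cons,
          List.map_nil] at hs
        rw [List.sublist_append_iff] at hs
        obtain ⟨l₁, l₂, he, h1, h2⟩ := hs
        rw [List.sublist_singleton] at h2
        rcases h2 with rfl | rfl
        · left
          simpa [he] using h1
        · right
          obtain ⟨rfl, h⟩ := List.append_inj' he rfl
          simp only [List.cons.injEq, and_true] at h
          exact ⟨h1, h.symm⟩
      have hn : (0 : ℝ) < Fintype.card V := by exact_mod_cast Fintype.card_pos
      calc (scheduleMeasure V).real {s | (l' ++ [x]).Sublist ((List.range (T + 1)).map s)}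
          ≤ (scheduleMeasure V).real {s | (l' ++ [x]).Sublist ((List.range T).map s)} +
            (scheduleMeasure V).real
              ({s | l'.Sublist ((List.range T).map s)} ∩ {s | s T = x}) :=
            (measureReal_mono hsub).trans (measureReal_union_le _ _)
        _ ≤ (T.choose (l'.length + 1) : ℝ) / (Fintype.card V : ℝ) ^ (l'.length + 1) +
            (T.choose l'.length : ℝ) / (Fintype.card V : ℝ) ^ l'.length *
              (1 / Fintype.card V) := by
            rw [scheduleMeasure_real_inter_eq (T := T)
              (A := {s | l'.Sublist ((List.range T).map s)}) (hdep T l')]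
            have := ih (l' ++ [x])
            simp only [List.length_append, List.length_cons, List.length_nil, zero_add] at this
            gcongr
            exact ih l'
        _ = _ := by
            simp only [List.length_append, List.length_cons, List.length_nil, zero_add,
              Nat.choose_succ_succ]
            push_cast
            field_simp
            ring

lemma scheduleMeasure_real_forall_notMem [Nonempty V] (T : ℕ) (F : Finset V) :
    (scheduleMeasure V).real {s | ∀ k < T, s k ∉ F} =
      (1 - (F.card : ℝ) / Fintype.card V) ^ T := by
  have hset : {s : ℕ → V | ∀ k < T, s k ∉ F} =
      Set.pi (Finset.range T : Set ℕ) fun _ => ((F : Set V)ᶜ) := by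
    ext s
    simp [Set.mem_pi]
  rw [hset, measureReal_def, Measure.infinitePi_pi _ fun _ _ => MeasurableSet.of_discrete,
    Finset.prod_const, Finset.card_range, ENNReal.toReal_pow, ← measureReal_def,
    probReal_compl_eq_one_sub MeasurableSet.of_discrete, uniformOn_univ_real]

open Classical in
/-- The number of nodes not selected within `T` steps. -/
noncomputable def numUnselected (s : ℕ → V) (T : ℕ) : ℕ :=
  (Finset.univ.filter fun v => ∀ k < T, s k ≠ v).card

/-- Being unselected is a negatively correlated family of events, so the number of unselected nodes
is concentrated by Chebyshev's inequality. -/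
lemma scheduleMeasure_real_lt_numUnselected_le [Nonempty V] (T : ℕ) {ε : ℝ} (hε : 0 < ε) :
    (scheduleMeasure V).real
      {s | (Real.exp (-((T : ℝ) / Fintype.card V)) + ε) * Fintype.card V < numUnselected s T} ≤
      1 / (ε ^ 2 * Fintype.card V) := by
  classical
  set n : ℝ := (Fintype.card V : ℝ) with hn
  have hn1 : 1 ≤ n := by
    rw [hn]
    exact_mod_cast Fintype.card_pos
  set A : V → Set (ℕ → V) := fun v => {s | ∀ k < T, s k ≠ v} with hA
  have hAm : ∀ v, MeasurableSet (A v) := fun v =>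
    measurableSet_of_forall_lt fun s s' h hs k hk => by
      rw [← h k hk]
      exact hs k hk
  set Z : V → (ℕ → V) → ℝ := fun v => (A v).indicator fun _ => 1 with hZ
  have hZL : ∀ v, MemLp (Z v) 2 (scheduleMeasure V) := fun v =>
    memLp_indicator_const 2 (hAm v) 1 (Or.inr (by simp))
  have hEZ : ∀ v, ∫ s, Z v s ∂scheduleMeasure V = (1 - 1 / n) ^ T := by
    intro v
    have := scheduleMeasure_real_forall_notMem T ({v} : Finset V)
    simp only [hZ]
    rw [integral_indicator_const _ (hAm v)]
    simpa [hA] using this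
  have hsum : ∀ s, (∑ v, Z v) s = numUnselected s T := by
    intro s
    simp [hZ, hA, Set.indicator_apply, numUnselected]
  have hcov : ∀ v w, cov[Z v, Z w; scheduleMeasure V] ≤ if v = w then 1 else 0 := by
    intro v w
    have hmul : Z v * Z w = (A v ∩ A w).indicator fun _ => 1 := by
      funext s
      by_cases hv : s ∈ A v <;> by_cases hw : s ∈ A w <;> simp [hZ, hv, hw]
    rw [covariance_eq_sub (hZL v) (hZL w), hmul,
      integral_indicator_const _ ((hAm v).inter (hAm w)), hEZ, hEZ]
    simp only [smul_eq_mul, mul_one]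
    have h1n : 0 ≤ 1 - 1 / n := by
      rw [sub_nonneg, div_le_one (by linarith)]
      exact hn1
    split_ifs with hvw
    · have : (scheduleMeasure V).real (A v ∩ A w) ≤ 1 := measureReal_le_one
      have := mul_nonneg (pow_nonneg h1n T) (pow_nonneg h1n T)
      linarith
    · have hF := scheduleMeasure_real_forall_notMem T ({v, w} : Finset V)
      have hset : A v ∩ A w = {s | ∀ k < T, s k ∉ ({v, w} : Finset V)} := by
        ext s
        simp [hA, forall_and]
      have hcard : 2 ≤ n := by
        rw [hn]
        have := Finset.card_le_univ ({v, w} : Finset V)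
        rw [Finset.card_pair hvw] at this
        exact_mod_cast this
      rw [hset, hF, Finset.card_pair hvw, ← mul_pow, sub_nonpos]
      push_cast
      refine pow_le_pow_left₀ ?_ ?_ T
      · rw [sub_nonneg, div_le_one (by linarith)]
        exact hcard
      · have : 0 ≤ (1 / n) ^ 2 := by positivity
        have e : (1 - 1 / n) * (1 - 1 / n) = 1 - 2 / n + (1 / n) ^ 2 := by ring
        rw [e]
        linarith
  have hvar : Var[∑ v, Z v; scheduleMeasure V] ≤ n := by
    rw [variance_sum hZL]
    calc ∑ v, ∑ w, cov[Z v, Z w; scheduleMeasure V]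
        ≤ ∑ v : V, ∑ w : V, if v = w then (1 : ℝ) else 0 :=
          Finset.sum_le_sum fun v _ => Finset.sum_le_sum fun w _ => hcov v w
      _ = n := by simp [hn]
  have hmean : ∫ s, (∑ v, Z v) s ∂scheduleMeasure V ≤ n * Real.exp (-(T / n)) := by
    simp only [Finset.sum_apply]
    rw [integral_finsetSum _ fun v _ => (hZL v).integrable (by norm_num)]
    simp only [hEZ, Finset.sum_const, Finset.card_univ, nsmul_eq_mul, ← hn]
    gcongr
    calc (1 - 1 / n) ^ T ≤ Real.exp (-(1 / n)) ^ T := by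
          refine pow_le_pow_left₀ ?_ ?_ T
          · rw [sub_nonneg, div_le_one (by linarith)]
            exact hn1
          · linarith [Real.add_one_le_exp (-(1 / n))]
      _ = Real.exp (-(T / n)) := by
          rw [← Real.exp_nat_mul]
          congr 1
          ring
  have hcheb := meas_ge_le_variance_div_sq (memLp_finsetSum' Finset.univ fun v _ => hZL v)
    (c := ε * n) (by positivity)
  have hsub : {s | (Real.exp (-((T : ℝ) / n)) + ε) * n < numUnselected s T} ⊆
      {s | ε * n ≤ |(∑ v, Z v) s - ∫ s, (∑ v, Z v) s ∂scheduleMeasure V|} := by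
    intro s hs
    simp only [Set.mem_ofPred_eq] at hs ⊢
    rw [hsum]
    refine le_trans ?_ (le_abs_self _)
    nlinarith
  calc _ ≤ (scheduleMeasure V).real
          {s | ε * n ≤ |(∑ v, Z v) s - ∫ s, (∑ v, Z v) s ∂scheduleMeasure V|} :=
        measureReal_mono hsub
    _ ≤ Var[∑ v, Z v; scheduleMeasure V] / (ε * n) ^ 2 :=
        ENNReal.toReal_le_of_le_ofReal
          (div_nonneg (variance_nonneg _ _) (by positivity)) hcheb
    _ ≤ n / (ε * n) ^ 2 := by gcongr
    _ = 1 / (ε ^ 2 * n) := by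
        field_simp

end Schedule

/-! ### Nodes selected before most of their neighbors -/

section Early

variable {V : Type u}

open Classical in
/-- `Early T M s S x` says that `x` is selected within the first `T` steps of the schedule `s`, and
that fewer than `M` nodes of `S` are selected before the first selection of `x`. -/
def Early (T M : ℕ) (s : ℕ → V) (S : Finset V) (x : V) : Prop :=
  ∃ k < T, s k = x ∧ (∀ j < k, s j ≠ x) ∧ (S.filter fun y => ∃ j < k, s j = y).card < M

open Classical in
/-- The last of the early nodes of `S` is preceded by all the others. -/
lemma card_filter_early_le (T M : ℕ) (s : ℕ → V) (S : Finset V) :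
    (S.filter fun x => Early T M s S x).card ≤ M := by
  rcases (S.filter fun x => Early T M s S x).eq_empty_or_nonempty with h | h
  · simp [h]
  · have hex : ∀ x, ∃ k, Early T M s S x → s k = x ∧
        (S.filter fun y => ∃ j < k, s j = y).card < M := by
      intro x
      by_cases hx : Early T M s S x
      · obtain ⟨k, -, h1, -, h3⟩ := hx
        exact ⟨k, fun _ => ⟨h1, h3⟩⟩
      · exact ⟨0, fun h => absurd h hx⟩
    choose τ hτ using hex
    obtain ⟨x, hx, hmax⟩ := Finset.exists_max_image _ τ h
    have hxE := (Finset.mem_filter.1 hx).2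
    have hsub : (S.filter fun x => Early T M s S x).erase x ⊆
        S.filter fun y => ∃ j < τ x, s j = y := by
      intro y hy
      rw [Finset.mem_erase] at hy
      have hy' := Finset.mem_filter.1 hy.2
      refine Finset.mem_filter.2 ⟨hy'.1, τ y, lt_of_le_of_ne (hmax y hy.2) fun e => hy.1 ?_,
        (hτ y hy'.2).1⟩
      rw [← (hτ y hy'.2).1, e, (hτ x hxE).1]
    have := Finset.card_le_card hsub
    rw [Finset.card_erase_of_mem hx] at this
    have := (hτ x hxE).2
    omega

lemma early_perm_iff {T M : ℕ} {s : ℕ → V} {S : Finset V} {x : V} {σ : Equiv.Perm V}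
    (hσ : ∀ y, σ y ∈ S ↔ y ∈ S) :
    Early T M (fun k => σ (s k)) S (σ x) ↔ Early T M s S x := by
  classical
  have hc : ∀ k, (S.filter fun y => ∃ j < k, σ (s j) = y).card =
      (S.filter fun y => ∃ j < k, s j = y).card := by
    intro k
    symm
    refine Finset.card_bij (fun y _ => σ y) ?_ ?_ ?_
    · intro y hy
      rw [Finset.mem_filter] at hy ⊢
      obtain ⟨hy, j, hj, rfl⟩ := hy
      exact ⟨(hσ _).2 hy, j, hj, rfl⟩
    · intro y _ z _ h
      exact σ.injective h
    · intro y hy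
      rw [Finset.mem_filter] at hy
      obtain ⟨hy, j, hj, rfl⟩ := hy
      exact ⟨s j, Finset.mem_filter.2 ⟨(hσ _).1 hy, j, hj, rfl⟩, rfl⟩
  simp only [Early, hc, ne_eq, EmbeddingLike.apply_eq_iff_eq]

lemma early_congr {T M : ℕ} {s s' : ℕ → V} {S : Finset V} {x : V} (h : ∀ k < T, s k = s' k)
    (hs : Early T M s S x) : Early T M s' S x := by
  classical
  obtain ⟨k, hk, h1, h2, h3⟩ := hs
  refine ⟨k, hk, by rw [← h k hk, h1], fun j hj => ?_, ?_⟩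
  · rw [← h j (hj.trans hk)]
    exact h2 j hj
  · have : ∀ y, (∃ j < k, s' j = y) ↔ ∃ j < k, s j = y := fun y =>
      exists_congr fun j => and_congr_right fun hj => by rw [h j (hj.trans hk)]
    simpa only [this] using h3

variable [Fintype V] [MeasurableSpace V] [DiscreteMeasurableSpace V]

/-- Nodes in disjoint sets `S w` are independently early, each with probability at most
`M / #(S w)`: all nodes of `S w` play symmetric roles, and at most `M` of them are early. The event
`A`, invariant under permutations within each `S w`, allows an induction over the nodes. -/
lemma scheduleMeasure_real_inter_early_mul_le [Nonempty V] (T M : ℕ) (S : V → Finset V)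
    (I : Finset V) (hS : (I : Set V).PairwiseDisjoint S) (hmem : ∀ w ∈ I, w ∈ S w)
    (A : Set (ℕ → V)) (hA : ∀ s s', (∀ k < T, s k = s' k) → s ∈ A → s' ∈ A)
    (hinv : ∀ w ∈ I, ∀ σ : Equiv.Perm V, (∀ y ∉ S w, σ y = y) →
      ∀ s, (fun k => σ (s k)) ∈ A ↔ s ∈ A) :
    (scheduleMeasure V).real (A ∩ {s | ∀ w ∈ I, Early T M s (S w) w}) *
      ∏ w ∈ I, ((S w).card : ℝ) ≤ (M : ℝ) ^ I.card * (scheduleMeasure V).real A := by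
  classical
  induction I using Finset.induction_on generalizing A with
  | empty => simp
  | insert a I ha ih =>
    set A' := A ∩ {s | Early T M s (S a) a} with hA'
    have hAm : MeasurableSet A := measurableSet_of_forall_lt hA
    have hpres : ∀ (F : Finset V) (σ : Equiv.Perm V), (∀ y ∉ F, σ y = y) →
        ∀ y, σ y ∈ F ↔ y ∈ F := by
      intro F σ h y
      by_cases hy : y ∈ F
      · refine iff_of_true ?_ hy
        by_contra hn
        have := h _ hn
        rw [σ.injective this] at hn
        exact hn hy
      · rw [h y hy]
    have h1 := ih (hS.subset (by simp)) (fun w hw => hmem w (by simp [hw])) A'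
      (fun s s' h hs => ⟨hA s s' h hs.1, early_congr h hs.2⟩) (by
        intro w hw σ hσ s
        have hdis : Disjoint (S a) (S w) :=
          hS (by simp) (by simp [hw]) (by rintro rfl; exact ha hw)
        have hfix : ∀ y ∈ S a, σ y = y := fun y hy => hσ y (Finset.disjoint_left.1 hdis hy)
        refine and_congr (hinv w (by simp [hw]) σ hσ s) ?_
        have hpr : ∀ y, σ y ∈ S a ↔ y ∈ S a := by
          intro y
          by_cases hy : y ∈ S a
          · rw [hfix y hy]
          · refine iff_of_false (fun hn => ?_) hy
            have := hfix _ hn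
            rw [σ.injective this] at hn
            exact hy hn
        have := early_perm_iff (T := T) (M := M) (s := s) (x := a) hpr
        rw [hfix a (hmem a (by simp))] at this
        exact this)
    have h2 : (scheduleMeasure V).real A' * (S a).card ≤ M * (scheduleMeasure V).real A := by
      have hE : ∀ y, MeasurableSet {s | Early T M s (S a) y} := fun y =>
        measurableSet_of_forall_lt (T := T) fun s s' h hs => early_congr h hs
      have hsymm : ∀ y ∈ S a, (scheduleMeasure V).real (A ∩ {s | Early T M s (S a) y}) =
          (scheduleMeasure V).real A' := by
        intro y hy
        have hσ : ∀ z ∉ S a, Equiv.swap a y z = z := fun z hz =>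
          Equiv.swap_apply_of_ne_of_ne (by rintro rfl; exact hz (hmem z (by simp)))
            (by rintro rfl; exact hz hy)
        rw [← scheduleMeasure_real_perm (Equiv.swap a y) (hAm.inter (hE a))]
        congr 1
        ext s
        refine and_congr (hinv a (by simp) _ hσ s).symm ?_
        have := early_perm_iff (T := T) (M := M) (s := s) (x := y) (hpres _ _ hσ)
        rw [Equiv.swap_apply_right] at this
        exact this.symm
      have hint : ∀ y, ∫ s, (A ∩ {s | Early T M s (S a) y}).indicator (fun _ => (1 : ℝ)) s
          ∂scheduleMeasure V = (scheduleMeasure V).real (A ∩ {s | Early T M s (S a) y}) := by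
        intro y
        rw [integral_indicator_const _ (hAm.inter (hE y))]
        simp
      calc (scheduleMeasure V).real A' * (S a).card
          = ∑ y ∈ S a, (scheduleMeasure V).real (A ∩ {s | Early T M s (S a) y}) := by
            rw [Finset.sum_congr rfl hsymm]
            simp [mul_comm]
        _ = ∫ s, ∑ y ∈ S a, (A ∩ {s | Early T M s (S a) y}).indicator (fun _ => (1 : ℝ)) s
              ∂scheduleMeasure V := by
            rw [integral_finsetSum _ fun y _ =>
              (integrable_const (1 : ℝ)).indicator (hAm.inter (hE y))]
            exact Finset.sum_congr rfl fun y _ => (hint y).symm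
        _ ≤ ∫ s, A.indicator (fun _ => (M : ℝ)) s ∂scheduleMeasure V := by
            refine integral_mono
              (integrable_finsetSum _ fun y _ =>
                (integrable_const (1 : ℝ)).indicator (hAm.inter (hE y)))
              ((integrable_const _).indicator hAm) fun s => ?_
            dsimp only
            by_cases hs : s ∈ A
            · have := card_filter_early_le T M s (S a)
              simp only [Set.indicator_apply, Set.mem_inter_iff, hs, true_and, Set.mem_ofPred_eq,
                if_true, Finset.sum_boole]
              exact_mod_cast this
            · simp [hs]
        _ = M * (scheduleMeasure V).real A := by
            rw [integral_indicator_const _ hAm, smul_eq_mul, mul_comm]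
    have hset : A ∩ {s | ∀ w ∈ insert a I, Early T M s (S w) w} =
        A' ∩ {s | ∀ w ∈ I, Early T M s (S w) w} := by
      ext s
      simp [hA', and_assoc]
    rw [hset, Finset.prod_insert ha, Finset.card_insert_of_notMem ha]
    calc _ = ((scheduleMeasure V).real (A' ∩ {s | ∀ w ∈ I, Early T M s (S w) w}) *
            ∏ w ∈ I, ((S w).card : ℝ)) * (S a).card := by ring
      _ ≤ ((M : ℝ) ^ I.card * (scheduleMeasure V).real A') * (S a).card := by gcongr
      _ = (M : ℝ) ^ I.card * ((scheduleMeasure V).real A' * (S a).card) := by ring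
      _ ≤ (M : ℝ) ^ I.card * (M * (scheduleMeasure V).real A) := by gcongr
      _ = _ := by ring

end Early

/-! ### Weighted non-backtracking walks -/

section Walks

variable {V : Type u} [Fintype V] {G : SimpleGraph V}

open Classical in
/-- The probability that the simple random walk without backtracking, started with the step from `u`
to `x`, is at `v` after `d` further steps. (At a leaf the walk dies.) -/
noncomputable def nonbacktrackingProb (G : SimpleGraph V) : ℕ → V → V → V → ℝ
  | 0, _, x, v => if x = v then 1 else 0
  | d + 1, u, x, v =>
      ∑ y ∈ (G.neighborFinset x).erase u,
        (((G.neighborFinset x).erase u).card : ℝ)⁻¹ * nonbacktrackingProb G d x y v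

lemma nonbacktrackingProb_nonneg (d : ℕ) (u x v : V) : 0 ≤ nonbacktrackingProb G d u x v := by
  induction d generalizing u x with
  | zero =>
    rw [nonbacktrackingProb]
    split_ifs <;> simp
  | succ d ih => exact Finset.sum_nonneg fun y _ => mul_nonneg (by positivity) (ih x y)

lemma sum_nonbacktrackingProb_le_one (d : ℕ) (u x : V) :
    ∑ v, nonbacktrackingProb G d u x v ≤ 1 := by
  classical
  induction d generalizing u x with
  | zero => simp [nonbacktrackingProb]
  | succ d ih =>
    simp only [nonbacktrackingProb]
    rw [Finset.sum_comm]
    simp only [← Finset.mul_sum]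
    calc (((G.neighborFinset x).erase u).card : ℝ)⁻¹ *
          ∑ y ∈ (G.neighborFinset x).erase u, ∑ v, nonbacktrackingProb G d x y v
        ≤ (((G.neighborFinset x).erase u).card : ℝ)⁻¹ *
          ∑ y ∈ (G.neighborFinset x).erase u, (1 : ℝ) := by
          gcongr with y
          exact ih x y
      _ ≤ 1 := by
          simp only [Finset.sum_const, nsmul_eq_mul, mul_one]
          exact inv_mul_le_one

open Classical in
/-- A single path is one way for the non-backtracking walk to get from one end to the other. -/
lemma prod_map_inv_le_nonbacktrackingProb {c : V → ℝ} {x v : V} (p : G.Walk x v) :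
    ∀ u, G.Adj u x → p.IsPath → u ∉ p.support →
      (∀ w ∈ p.support.dropLast, (G.degree w : ℝ) ≤ c w + 1) →
      (p.support.dropLast.map fun w => (c w)⁻¹).prod ≤ nonbacktrackingProb G p.length u x v := by
  induction p with
  | nil => simp [nonbacktrackingProb]
  | @cons x y v h p ih =>
    intro u hux hp hu hc
    rw [SimpleGraph.Walk.cons_isPath_iff] at hp
    have hdl : (SimpleGraph.Walk.cons h p).support.dropLast = x :: p.support.dropLast := by
      rw [SimpleGraph.Walk.support_cons, List.dropLast_cons_of_ne_nil p.support_ne_nil]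
    rw [hdl] at hc ⊢
    simp only [SimpleGraph.Walk.support_cons, List.mem_cons, not_or] at hu
    have hy : y ∈ (G.neighborFinset x).erase u := by
      rw [Finset.mem_erase, SimpleGraph.mem_neighborFinset]
      exact ⟨fun e => hu.2 (e ▸ p.start_mem_support), h⟩
    have hcard : 0 < ((G.neighborFinset x).erase u).card := Finset.card_pos.2 ⟨y, hy⟩
    have hcx : (((G.neighborFinset x).erase u).card : ℝ) ≤ c x := by
      have h1 := hc x (by simp)
      have h2 : ((G.neighborFinset x).erase u).card + 1 = G.degree x := by
        rw [Finset.card_erase_add_one ((G.mem_neighborFinset x u).2 hux.symm),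
          SimpleGraph.card_neighborFinset_eq_degree]
      have h3 : (((G.neighborFinset x).erase u).card : ℝ) + 1 = G.degree x := by exact_mod_cast h2
      linarith
    have hih := ih x h hp.1 hp.2 fun w hw => hc w (by simp [hw])
    rw [List.map_cons, List.prod_cons, SimpleGraph.Walk.length_cons, nonbacktrackingProb]
    have hpos : (0 : ℝ) < ((G.neighborFinset x).erase u).card := by exact_mod_cast hcard
    calc (c x)⁻¹ * (p.support.dropLast.map fun w => (c w)⁻¹).prod
        ≤ (c x)⁻¹ * nonbacktrackingProb G p.length x y v := by
          have : 0 ≤ (c x)⁻¹ := inv_nonneg.2 (hpos.le.trans hcx)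
          gcongr
      _ ≤ (((G.neighborFinset x).erase u).card : ℝ)⁻¹ * nonbacktrackingProb G p.length x y v := by
          have := nonbacktrackingProb_nonneg (G := G) p.length x y v
          gcongr
      _ ≤ _ := Finset.single_le_sum
          (f := fun y => (((G.neighborFinset x).erase u).card : ℝ)⁻¹ *
            nonbacktrackingProb G p.length x y v)
          (fun y _ => mul_nonneg (inv_nonneg.2 hpos.le) (nonbacktrackingProb_nonneg _ _ _ _)) hy

end Walks

/-! ### Schedules under which two nodes are correlated -/

section Pairs

variable {V : Type u} [Fintype V] [MeasurableSpace V] [DiscreteMeasurableSpace V]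
  {G : SimpleGraph V} {δ : ℝ}

open Classical in
/-- The node `w` of a path together with its neighbors off the path. -/
noncomputable def offPath (G : SimpleGraph V) {u v : V} (p : G.Walk u v) (w : V) : Finset V :=
  insert w (G.neighborFinset w \ p.support.toFinset)

omit [MeasurableSpace V] [DiscreteMeasurableSpace V] in
lemma offPath_disjoint (hG : G.IsTree) {u v w w' : V} {p : G.Walk u v}
    (hw : w ∈ p.support) (hw' : w' ∈ p.support) (hne : w ≠ w') :
    Disjoint (offPath G p w) (offPath G p w') := by
  classical
  rw [Finset.disjoint_left]
  intro x hx hx'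
  simp only [offPath, Finset.mem_insert, Finset.mem_sdiff, SimpleGraph.mem_neighborFinset,
    List.mem_toFinset] at hx hx'
  rcases hx with rfl | ⟨hx, hxp⟩
  · rcases hx' with h | ⟨-, h⟩
    · exact hne h
    · exact h hw
  rcases hx' with rfl | ⟨hx', -⟩
  · exact hxp hw'
  -- the walk from `w` to `w'` along `p` must contain the path through `x`
  have hq : (SimpleGraph.Walk.cons hx (SimpleGraph.Walk.cons hx'.symm .nil)).IsPath := by
    simp [hx.ne, hx'.ne', hne]
  have hsub := (support_sublist_of_isPath hG hq
    ((p.takeUntil w hw).reverse.append (p.takeUntil w' hw'))).subset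
    (show x ∈ _ by simp)
  rw [SimpleGraph.Walk.mem_support_append_iff, SimpleGraph.Walk.support_reverse,
    List.mem_reverse] at hsub
  rcases hsub with h | h
  · exact hxp (p.support_takeUntil_subset_support hw h)
  · exact hxp (p.support_takeUntil_subset_support hw' h)

open Classical in
omit [MeasurableSpace V] [DiscreteMeasurableSpace V] in
/-- At most two neighbors of a node of a path in a tree are on the path. -/
lemma degree_le_card_offPath (hG : G.IsTree) {u v w : V} {p : G.Walk u v} (hp : p.IsPath)
    (hw : w ∈ p.support) : G.degree w ≤ (offPath G p w).card + 1 := by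
  have h1 : (G.neighborFinset w ∩ p.support.toFinset).card ≤ 2 := by
    refine (Finset.card_le_card (t := {(p.takeUntil w hw).penultimate,
      (p.dropUntil w hw).snd}) ?_).trans Finset.card_le_two
    intro x hx
    simp only [Finset.mem_inter, SimpleGraph.mem_neighborFinset, List.mem_toFinset] at hx
    have hx2 := hx.2
    rw [← p.take_spec hw, SimpleGraph.Walk.mem_support_append_iff] at hx2
    rw [Finset.mem_insert, Finset.mem_singleton]
    exact hx2.imp (fun h => hG.isAcyclic.eq_penultimate_of_adj_end (hp.takeUntil hw) hx.1 h)
      (fun h => hG.isAcyclic.eq_snd_of_adj_start (hp.dropUntil hw) hx.1 h)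
  have h2 : (offPath G p w).card = (G.neighborFinset w \ p.support.toFinset).card + 1 := by
    rw [offPath, Finset.card_insert_of_notMem]
    simp
  have h3 := Finset.card_sdiff_add_card_inter (G.neighborFinset w) p.support.toFinset
  rw [SimpleGraph.card_neighborFinset_eq_degree] at h3
  omega

open Classical in
omit [MeasurableSpace V] [DiscreteMeasurableSpace V] in
lemma le_card_of_not_early {T M k : ℕ} {s : ℕ → V} {u v w : V} {p : G.Walk u v}
    (h : ¬ Early T M s (offPath G p w) w) (hk : k < T) (hsk : s k = w) :
    M ≤ (Finset.univ.filter fun x => G.Adj w x ∧ ∃ j < k, s j = x).card := by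
  have hex : ∃ k, s k = w := ⟨k, hsk⟩
  have hle : Nat.find hex ≤ k := Nat.find_min' hex hsk
  have hnot : ∀ j < Nat.find hex, s j ≠ w := fun j hj => Nat.find_min hex hj
  by_contra hlt
  refine h ⟨Nat.find hex, lt_of_le_of_lt hle hk, Nat.find_spec hex, hnot, ?_⟩
  refine lt_of_le_of_lt (Finset.card_le_card ?_) (not_le.1 hlt)
  intro y hy
  simp only [offPath, Finset.mem_filter, Finset.mem_insert, Finset.mem_sdiff,
    SimpleGraph.mem_neighborFinset] at hy
  obtain ⟨hy1, j, hj, hy2⟩ := hy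
  rcases hy1 with rfl | ⟨hadj, -⟩
  · exact absurd hy2 (hnot j hj)
  · exact Finset.mem_filter.2 ⟨Finset.mem_univ _, hadj, j, hj.trans_le hle, hy2⟩

open Classical in
/-- The short-range case: the announcements at the ends of a path are essentially uncorrelated
unless all inner nodes of the path are selected before most of their neighbors. -/
lemma exists_schedule_event_of_path [Nonempty V] (hG : G.IsTree) (h₀ : 0 < δ) (h₁ : δ < 1 / 2)
    (T M : ℕ) {u x v : V} (h : G.Adj u x) (p : G.Walk x v)
    (hp : (SimpleGraph.Walk.cons h p).IsPath) :
    ∃ E : Set (ℕ → V), MeasurableSet E ∧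
      (∀ s ∉ E, correctnessCov G δ s T u v ≤ 3 * (T * Real.exp (-(2 * δ ^ 2 * M)))) ∧
      (scheduleMeasure V).real E ≤ (M : ℝ) ^ p.length * nonbacktrackingProb G p.length u x v := by
  set q := SimpleGraph.Walk.cons h p with hq
  have hp' := (SimpleGraph.Walk.cons_isPath_iff h p).1 hp
  set l := p.support.dropLast with hl
  have hlsub : ∀ w ∈ l, w ∈ q.support := fun w hw => by
    rw [hq, SimpleGraph.Walk.support_cons]
    exact List.mem_cons_of_mem _ (List.mem_of_mem_dropLast hw)
  have hnodup : l.Nodup := hp'.1.support_nodup.sublist (List.dropLast_sublist _)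
  set E : Set (ℕ → V) := {s | ∀ w ∈ l.toFinset, Early T M s (offPath G q w) w} with hE
  refine ⟨E, measurableSet_of_forall_lt (T := T) fun s s' hs hsE w hw =>
    early_congr hs (hsE w hw), fun s hs => ?_, ?_⟩
  · simp only [hE, Set.mem_ofPred_eq, not_forall, List.mem_toFinset] at hs
    obtain ⟨w, hw, hearly⟩ := hs
    have hwp : w ∈ p.support := List.mem_of_mem_dropLast hw
    refine correctnessCov_le hG h₀ h₁ (fun e => hp'.2 (e ▸ hwp)) ?_
      (fun r => (support_sublist_of_isPath hG hp r).subset (hlsub w hw))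
      (fun k hk hsk => le_card_of_not_early hearly hk hsk)
    rintro rfl
    have h2 := hp'.1.support_nodup
    rw [← List.dropLast_append_getLast p.support_ne_nil, List.nodup_append,
      SimpleGraph.Walk.getLast_support] at h2
    exact h2.2.2 v hw v (by simp) rfl
  · have hprob := scheduleMeasure_real_inter_early_mul_le T M (offPath G q) l.toFinset
      (fun w hw w' hw' hne => offPath_disjoint hG (hlsub w (by simpa using hw))
        (hlsub w' (by simpa using hw')) hne)
      (fun w _ => by simp [offPath]) Set.univ (fun _ _ _ _ => trivial)
      (fun _ _ _ _ _ => Iff.rfl)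
    have hlen : l.toFinset.card = p.length := by
      rw [List.toFinset_card_of_nodup hnodup, hl, List.length_dropLast,
        SimpleGraph.Walk.length_support]
      rfl
    rw [Set.univ_inter, probReal_univ, mul_one, hlen] at hprob
    have hpos : ∀ w ∈ l.toFinset, (0 : ℝ) < (offPath G q w).card := fun w _ => by
      have : 0 < (offPath G q w).card := Finset.card_pos.2 ⟨w, by simp [offPath]⟩
      exact_mod_cast this
    have hprodpos : 0 < ∏ w ∈ l.toFinset, ((offPath G q w).card : ℝ) := Finset.prod_pos hpos
    have hnb := prod_map_inv_le_nonbacktrackingProb (c := fun w => ((offPath G q w).card : ℝ)) p u h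
      hp'.1 hp'.2 fun w hw => by
        exact_mod_cast degree_le_card_offPath hG hp (hlsub w hw)
    rw [← List.prod_toFinset _ hnodup, Finset.prod_inv_distrib] at hnb
    calc (scheduleMeasure V).real E
        ≤ (M : ℝ) ^ p.length * (∏ w ∈ l.toFinset, ((offPath G q w).card : ℝ))⁻¹ := by
          rw [← div_eq_mul_inv, le_div_iff₀ hprodpos]
          exact hprob
      _ ≤ _ := by gcongr

/-- The long-range case: the announcements at the ends of a path of length at least `2 * R` are
uncorrelated unless a signal travels at least `R` steps along this path. -/
lemma exists_schedule_event_of_long_path [Nonempty V] (hG : G.IsTree)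
    (h₀ : 0 < δ) (h₁ : δ < 1 / 2) (T R : ℕ) {u v : V} (p : G.Walk u v) (hp : p.IsPath)
    (hR : 2 * R ≤ p.length) :
    ∃ E : Set (ℕ → V), MeasurableSet E ∧ (∀ s ∉ E, correctnessCov G δ s T u v ≤ 0) ∧
      (scheduleMeasure V).real E ≤
        2 * ((T.choose R : ℝ) / (Fintype.card V : ℝ) ^ R) := by
  classical
  have hprob := isProbabilityMeasure_signalLaw (δ := δ) (by linarith) h₁.le
  set l₁ := ((p.take R).reverse.support).take R with hl₁
  set l₂ := ((p.drop R).support).take R with hl₂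
  have hlen₁ : l₁.length = R := by
    rw [hl₁, List.length_take, SimpleGraph.Walk.length_support, SimpleGraph.Walk.length_reverse,
      SimpleGraph.Walk.take_length]
    omega
  have hlen₂ : l₂.length = R := by
    rw [hl₂, List.length_take, SimpleGraph.Walk.length_support, SimpleGraph.Walk.drop_length]
    omega
  have hmeas : ∀ l : List V, MeasurableSet {s : ℕ → V | l.Sublist ((List.range T).map s)} :=
    fun l => measurableSet_of_forall_lt (T := T) fun s s' hs hl => by
      rw [Set.mem_ofPred_eq] at hl ⊢
      rwa [List.map_congr_left (g := s') fun k hk => hs k (by simpa using hk)] at hl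
  refine ⟨{s | l₁.Sublist ((List.range T).map s)} ∪ {s | l₂.Sublist ((List.range T).map s)},
    (hmeas l₁).union (hmeas l₂), fun s hs => ?_, ?_⟩
  · rw [Set.mem_union, not_or] at hs
    refine (correctnessCov_eq_zero fun x p₁ p₂ h1 h2 => ?_).le
    have hm : p.getVert R ∈ (p₁.reverse.append p₂).support := by
      refine (support_sublist_of_isPath hG hp _).subset ?_
      exact p.getVert_mem_support R
    rw [SimpleGraph.Walk.mem_support_append_iff, SimpleGraph.Walk.support_reverse,
      List.mem_reverse] at hm
    rcases hm with hm | hm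
    · refine hs.1 (((List.take_sublist _ _).trans ?_).trans h1)
      exact (support_sublist_of_isPath hG (hp.take R).reverse (p₁.dropUntil _ hm)).trans
        (p₁.support_dropUntil_suffix_support hm).sublist
    · refine hs.2 (((List.take_sublist _ _).trans ?_).trans h2)
      exact (support_sublist_of_isPath hG (hp.drop R) (p₂.dropUntil _ hm)).trans
        (p₂.support_dropUntil_suffix_support hm).sublist
  · have e1 := scheduleMeasure_real_sublist_le T l₁
    have e2 := scheduleMeasure_real_sublist_le T l₂
    rw [hlen₁] at e1
    rw [hlen₂] at e2
    linarith [measureReal_union_le (μ := scheduleMeasure V)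
      {s | l₁.Sublist ((List.range T).map s)} {s | l₂.Sublist ((List.range T).map s)}]

open Classical in
lemma exists_schedule_event [Nonempty V] (hG : G.IsTree) (h₀ : 0 < δ) (h₁ : δ < 1 / 2)
    (T M R : ℕ) (u v : V) :
    ∃ E : Set (ℕ → V), MeasurableSet E ∧
      (∀ s ∉ E, correctnessCov G δ s T u v ≤ 3 * (T * Real.exp (-(2 * δ ^ 2 * M)))) ∧
      (scheduleMeasure V).real E ≤ (if u = v then 1 else 0) +
        (∑ r ∈ Finset.range (2 * R), (M : ℝ) ^ r *
          ∑ x ∈ G.neighborFinset u, nonbacktrackingProb G r u x v) +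
        2 * ((T.choose R : ℝ) / (Fintype.card V : ℝ) ^ R) := by
  obtain ⟨p, hp, -⟩ := hG.existsUnique_path u v
  have hQ : ∀ r, 0 ≤ (M : ℝ) ^ r * ∑ x ∈ G.neighborFinset u, nonbacktrackingProb G r u x v :=
    fun r => mul_nonneg (by positivity)
      (Finset.sum_nonneg fun x _ => nonbacktrackingProb_nonneg _ _ _ _)
  have h1 : (0 : ℝ) ≤ if u = v then 1 else 0 := by split_ifs <;> simp
  have h2 : 0 ≤ ∑ r ∈ Finset.range (2 * R), (M : ℝ) ^ r *
      ∑ x ∈ G.neighborFinset u, nonbacktrackingProb G r u x v :=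
    Finset.sum_nonneg fun r _ => hQ r
  have h3 : 0 ≤ 2 * ((T.choose R : ℝ) / (Fintype.card V : ℝ) ^ R) := by positivity
  rcases le_or_gt (2 * R) p.length with hR | hR
  · obtain ⟨E, hE, hcov, hle⟩ := exists_schedule_event_of_long_path hG h₀ h₁ T R p hp hR
    exact ⟨E, hE, fun s hs => (hcov s hs).trans (by positivity), by linarith⟩
  · cases p with
    | nil =>
      refine ⟨Set.univ, MeasurableSet.univ, fun s hs => absurd (Set.mem_univ s) hs, ?_⟩
      rw [probReal_univ, if_pos rfl]
      linarith
    | @cons _ x _ h p =>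
      obtain ⟨E, hE, hcov, hle⟩ := exists_schedule_event_of_path hG h₀ h₁ T M h p hp
      refine ⟨E, hE, hcov, ?_⟩
      have hlen : p.length < 2 * R := by
        rw [SimpleGraph.Walk.length_cons] at hR
        omega
      have e1 := Finset.single_le_sum (f := fun r => (M : ℝ) ^ r *
        ∑ x ∈ G.neighborFinset u, nonbacktrackingProb G r u x v) (fun r _ => hQ r)
        (Finset.mem_range.2 hlen)
      have e2 := Finset.single_le_sum (f := fun x => nonbacktrackingProb G p.length u x v)
        (fun x _ => nonbacktrackingProb_nonneg _ _ _ _) ((G.mem_neighborFinset u x).2 h)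
      have e3 := mul_le_mul_of_nonneg_left e2 (show 0 ≤ (M : ℝ) ^ p.length by positivity)
      linarith

open Classical in
omit [MeasurableSpace V] [DiscreteMeasurableSpace V] in
lemma sum_sum_nonbacktrackingProb_le (hG : G.IsTree) {M : ℕ} (hM : 1 ≤ M) (R : ℕ) :
    ∑ u : V, ∑ v : V, ∑ r ∈ Finset.range (2 * R), (M : ℝ) ^ r *
        ∑ x ∈ G.neighborFinset u, nonbacktrackingProb G r u x v ≤
      2 * R * ((M : ℝ) ^ (2 * R) * (2 * Fintype.card V)) := by
  have hM' : (1 : ℝ) ≤ M := by exact_mod_cast hM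
  have hdeg : ∑ u : V, (G.degree u : ℝ) ≤ 2 * Fintype.card V := by
    have h1 := G.sum_degrees_eq_twice_card_edges
    have h2 := hG.card_edgeFinset
    have h3 : ∑ u : V, G.degree u ≤ 2 * Fintype.card V := by omega
    exact_mod_cast h3
  have hu : ∀ u r, ∑ v : V, ∑ x ∈ G.neighborFinset u, nonbacktrackingProb G r u x v ≤
      G.degree u := by
    intro u r
    rw [Finset.sum_comm]
    calc _ ≤ ∑ x ∈ G.neighborFinset u, (1 : ℝ) :=
          Finset.sum_le_sum fun x _ => sum_nonbacktrackingProb_le_one r u x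
      _ = G.degree u := by simp
  calc ∑ u : V, ∑ v : V, ∑ r ∈ Finset.range (2 * R), (M : ℝ) ^ r *
        ∑ x ∈ G.neighborFinset u, nonbacktrackingProb G r u x v
      = ∑ r ∈ Finset.range (2 * R), (M : ℝ) ^ r *
          ∑ u : V, ∑ v : V, ∑ x ∈ G.neighborFinset u, nonbacktrackingProb G r u x v := by
        refine (Finset.sum_congr rfl fun u _ => Finset.sum_comm).trans (Finset.sum_comm.trans ?_)
        simp only [Finset.mul_sum]
    _ ≤ ∑ r ∈ Finset.range (2 * R), (M : ℝ) ^ (2 * R) * ∑ u : V, (G.degree u : ℝ) := by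
        refine Finset.sum_le_sum fun r hr => ?_
        have hr' := (Finset.mem_range.1 hr).le
        have hnn : 0 ≤ ∑ u : V, (G.degree u : ℝ) := Finset.sum_nonneg fun u _ => by positivity
        exact mul_le_mul (pow_le_pow_right₀ hM' hr') (Finset.sum_le_sum fun u _ => hu u r)
          (Finset.sum_nonneg fun u _ => Finset.sum_nonneg fun v _ =>
            Finset.sum_nonneg fun x _ => nonbacktrackingProb_nonneg _ _ _ _) (by positivity)
    _ ≤ ∑ r ∈ Finset.range (2 * R), (M : ℝ) ^ (2 * R) * (2 * Fintype.card V) := by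
        gcongr
    _ = _ := by simp

end Pairs

/-! ### The number of Correct announcements -/

section Concentration

variable {V : Type u} [Fintype V] {G : SimpleGraph V} {δ : ℝ}

lemma announcement_congr {X : V → Bool} {s s' : ℕ → V} {T : ℕ} (h : ∀ k < T, s k = s' k) :
    announcement G X s T = announcement G X s' T := by
  induction T with
  | zero => rfl
  | succ T ih =>
    funext v
    simp only [announcement, ih fun k hk => h k (by omega)]
    rw [h T (by omega)]

lemma cast_numCorrect (X : V → Bool) (s : ℕ → V) (T : ℕ) :
    (numCorrect G X s T : ℝ) = ∑ v, correctness (announcement G X s T v) := by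
  simp [numCorrect, correctness]

lemma mul_card_sub_numUnselected_le (h₀ : 0 ≤ δ) (h₁ : δ < 1 / 2) (s : ℕ → V) (T : ℕ) :
    (1 / 2 + δ) * (Fintype.card V - numUnselected s T) ≤
      ∫ X, ∑ v, correctness (announcement G X s T v) ∂signalMeasure V δ := by
  classical
  have hprob := isProbabilityMeasure_signalLaw (δ := δ) (by linarith) h₁.le
  rw [integral_finsetSum _ fun v _ => Integrable.of_finite]
  have hpt : ∀ v, (1 / 2 + δ) * (1 - if ∀ k < T, s k ≠ v then 1 else 0) ≤
      ∫ X, correctness (announcement G X s T v) ∂signalMeasure V δ := by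
    intro v
    split_ifs with h
    · simp only [sub_self, mul_zero]
      exact integral_correctness_nonneg _
    · push Not at h
      have := integral_forcedAnnouncement_ge (G := G) (s := s) h₀ h₁ (Set.notMem_empty v) h
      simp only [forcedAnnouncement_empty] at this
      linarith
  calc _ = ∑ v, (1 / 2 + δ) * (1 - if ∀ k < T, s k ≠ v then 1 else 0) := by
        rw [← Finset.mul_sum, Finset.sum_sub_distrib, Finset.sum_boole, numUnselected]
        simp
    _ ≤ _ := Finset.sum_le_sum fun v _ => hpt v

/-- Chebyshev's inequality over the signals, for a fixed schedule that leaves few nodes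
unselected. -/
lemma signalMeasure_numCorrect_lt_le (h₀ : 0 < δ) (h₁ : δ < 1 / 2) [Nonempty V] (s : ℕ → V) (T : ℕ)
    {ε : ℝ} (hε : 0 ≤ ε)
    (hs : (numUnselected s T : ℝ) ≤ (ε + δ / 4) * Fintype.card V) :
    signalMeasure V δ {X | (numCorrect G X s T : ℝ) < (1 / 2 + δ / 2 - ε) * Fintype.card V} ≤
      ENNReal.ofReal (16 / (δ ^ 2 * (Fintype.card V : ℝ) ^ 2) *
        ∑ u, ∑ v, correctnessCov G δ s T u v) := by
  have hprob := isProbabilityMeasure_signalLaw (δ := δ) (by linarith) h₁.le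
  set n : ℝ := (Fintype.card V : ℝ) with hn
  have hn0 : 0 < n := by
    rw [hn]
    exact_mod_cast Fintype.card_pos
  set f : V → (V → Bool) → ℝ := fun v X => correctness (announcement G X s T v) with hf
  have hvar : Var[fun X => ∑ v, f v X; signalMeasure V δ] =
      ∑ u, ∑ v, correctnessCov G δ s T u v := by
    rw [variance_fun_sum fun v => MemLp.of_discrete]
    rfl
  have hcheb := meas_ge_le_variance_div_sq (μ := signalMeasure V δ) (X := fun X => ∑ v, f v X)
    MemLp.of_discrete (c := δ / 4 * n) (by positivity)
  rw [hvar] at hcheb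
  have hmean := mul_card_sub_numUnselected_le (G := G) h₀.le h₁ s T
  rw [← hn] at hmean
  refine (measure_mono fun X hX => ?_).trans (hcheb.trans_eq ?_)
  · simp only [Set.mem_ofPred_eq] at hX ⊢
    rw [cast_numCorrect] at hX
    rw [abs_sub_comm]
    refine le_trans ?_ (le_abs_self _)
    change _ ≤ (∫ X, ∑ v, correctness (announcement G X s T v) ∂signalMeasure V δ) -
      ∑ v, correctness (announcement G X s T v)
    have : 0 ≤ (1 / 2 - δ) * (ε + δ / 4) * n :=
      mul_nonneg (mul_nonneg (by linarith) (by linarith)) hn0.le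
    nlinarith
  · congr 1
    field_simp
    norm_num

end Concentration

section Bound

variable {V : Type u} [Fintype V] [MeasurableSpace V] [DiscreteMeasurableSpace V]
  {G : SimpleGraph V} {δ : ℝ}

/-- The non-asymptotic form of the theorem, with a free degree threshold `M` and a free distance
threshold `R`. -/
lemma one_sub_le_probCorrect (hG : G.IsTree) (h₀ : 0 < δ) (h₁ : δ < 1 / 2)
    (T R : ℕ) {M : ℕ} (hM : 1 ≤ M) {n : ℝ} (hn : n = Fintype.card V) :
    1 - 16 / δ ^ 2 * (2 / n + 4 * R * (M : ℝ) ^ (2 * R) / n + 2 * ((T.choose R : ℝ) / n ^ R) +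
        3 * (T * Real.exp (-(2 * δ ^ 2 * M)))) ≤
      probCorrect G δ T ((1 / 2 + δ / 2 - Real.exp (-((T : ℝ) / n))) * n) := by
  classical
  have hprob := isProbabilityMeasure_signalLaw (δ := δ) (by linarith) h₁.le
  have hne : Nonempty V := hG.connected.nonempty
  have hn0 : 0 < n := by
    rw [hn]
    exact_mod_cast Fintype.card_pos
  set x := (1 / 2 + δ / 2 - Real.exp (-((T : ℝ) / n))) * n with hx
  set τ := 3 * (T * Real.exp (-(2 * δ ^ 2 * M))) with hτ
  have hτ0 : 0 ≤ τ := by positivity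
  choose E hEm hEcov hEle using exists_schedule_event hG h₀ h₁ T M R
  set U : Set (ℕ → V) :=
    {s | (Real.exp (-((T : ℝ) / n)) + δ / 4) * n < numUnselected s T} with hU
  have hUm : MeasurableSet U := measurableSet_of_forall_lt (T := T) fun s s' h hs => by
    have : numUnselected s' T = numUnselected s T := by
      rw [numUnselected, numUnselected]
      congr 1
      exact Finset.filter_congr fun v _ =>
        forall_congr' fun k => forall_congr' fun hk => by rw [h k hk]
    rw [hU, Set.mem_ofPred_eq, this]
    exact hs
  set good : Set ((V → Bool) × (ℕ → V)) := {ω | x ≤ (numCorrect G ω.1 ω.2 T : ℝ)} with hgood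
  have hgm : MeasurableSet good := measurableSet_prod_of_forall_lt (T := T)
    fun X s s' h hs => by
      simp only [hgood, Set.mem_ofPred_eq, numCorrect] at hs ⊢
      rwa [announcement_congr h] at hs
  set C := 16 / (δ ^ 2 * n ^ 2) with hC
  have hC0 : 0 ≤ C := by positivity
  set g : (ℕ → V) → ℝ := fun s => U.indicator (fun _ => (1 : ℝ)) s +
    C * ∑ u, ∑ v, ((E u v).indicator (fun _ => (1 : ℝ)) s + τ) with hg
  have hind : ∀ (A : Set (ℕ → V)) s, 0 ≤ A.indicator (fun _ => (1 : ℝ)) s := fun A s =>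
    Set.indicator_nonneg (fun _ _ => zero_le_one) s
  have hsum0 : ∀ s, 0 ≤ ∑ u, ∑ v, ((E u v).indicator (fun _ => (1 : ℝ)) s + τ) := fun s =>
    Finset.sum_nonneg fun u _ => Finset.sum_nonneg fun v _ => add_nonneg (hind _ _) hτ0
  have hg0 : ∀ s, 0 ≤ g s := fun s => add_nonneg (hind _ _) (mul_nonneg hC0 (hsum0 s))
  have hgint : Integrable g (scheduleMeasure V) := by
    refine ((integrable_const _).indicator hUm).add ((integrable_finsetSum _ fun u _ =>
      integrable_finsetSum _ fun v _ => ?_).const_mul C)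
    exact ((integrable_const _).indicator (hEm u v)).add (integrable_const _)
  have hslice : ∀ s, signalMeasure V δ ((fun X => (X, s)) ⁻¹' goodᶜ) ≤ ENNReal.ofReal (g s) := by
    intro s
    by_cases hs : s ∈ U
    · refine prob_le_one.trans ?_
      rw [ENNReal.one_le_ofReal]
      simp only [hg, Set.indicator_of_mem hs]
      linarith [mul_nonneg hC0 (hsum0 s)]
    · have hs' : (numUnselected s T : ℝ) ≤
          (Real.exp (-((T : ℝ) / n)) + δ / 4) * Fintype.card V := by
        rw [← hn]
        exact not_lt.1 hs
      have h := signalMeasure_numCorrect_lt_le (G := G) h₀ h₁ s T (Real.exp_pos _).le hs'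
      rw [← hn] at h
      have hpre : (fun X => (X, s)) ⁻¹' goodᶜ =
          {X | (numCorrect G X s T : ℝ) < x} := by
        ext X
        simp [hgood]
      rw [hpre]
      refine h.trans (ENNReal.ofReal_le_ofReal ?_)
      simp only [hg, Set.indicator_of_notMem hs, zero_add]
      refine mul_le_mul_of_nonneg_left (Finset.sum_le_sum fun u _ =>
        Finset.sum_le_sum fun v _ => ?_) hC0
      by_cases hE : s ∈ E u v
      · rw [Set.indicator_of_mem hE]
        linarith [correctnessCov_le_one (G := G) (δ := δ) (s := s) T u v]
      · rw [Set.indicator_of_notMem hE, zero_add]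
        exact hEcov u v s hE
  have hbad : (processLaw V δ).real goodᶜ ≤ ∫ s, g s ∂scheduleMeasure V := by
    refine ENNReal.toReal_le_of_le_ofReal (integral_nonneg hg0) ?_
    rw [processLaw, Measure.prod_apply_symm hgm.compl,
      ofReal_integral_eq_lintegral_ofReal hgint (Filter.Eventually.of_forall hg0)]
    exact lintegral_mono hslice
  have hintind : ∀ {A : Set (ℕ → V)}, MeasurableSet A →
      ∫ s, A.indicator (fun _ => (1 : ℝ)) s ∂scheduleMeasure V = (scheduleMeasure V).real A := by
    intro A hA
    rw [integral_indicator_const _ hA]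
    simp
  have hgval : ∫ s, g s ∂scheduleMeasure V = (scheduleMeasure V).real U +
      C * ∑ u, ∑ v, ((scheduleMeasure V).real (E u v) + τ) := by
    have hi : ∀ u v, Integrable (fun s => (E u v).indicator (fun _ => (1 : ℝ)) s + τ)
        (scheduleMeasure V) := fun u v =>
      ((integrable_const _).indicator (hEm u v)).add (integrable_const _)
    simp only [hg]
    rw [integral_add ((integrable_const _).indicator hUm) ((integrable_finsetSum _ fun u _ =>
      integrable_finsetSum _ fun v _ => hi u v).const_mul C), hintind hUm, integral_const_mul,
      integral_finsetSum _ fun u _ => integrable_finsetSum _ fun v _ => hi u v]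
    congr 2
    refine Finset.sum_congr rfl fun u _ => ?_
    rw [integral_finsetSum _ fun v _ => hi u v]
    refine Finset.sum_congr rfl fun v _ => ?_
    rw [integral_add ((integrable_const _).indicator (hEm u v)) (integrable_const _),
      hintind (hEm u v)]
    simp
  have hUle : (scheduleMeasure V).real U ≤ 1 / ((δ / 4) ^ 2 * n) := by
    have := scheduleMeasure_real_lt_numUnselected_le (V := V) T (ε := δ / 4) (by positivity)
    rw [← hn] at this
    exact this
  have hsumle : ∑ u, ∑ v, ((scheduleMeasure V).real (E u v) + τ) ≤
      n + 2 * R * ((M : ℝ) ^ (2 * R) * (2 * n)) + n ^ 2 * (2 * ((T.choose R : ℝ) / n ^ R)) +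
        n ^ 2 * τ := by
    have h1 : ∑ u, ∑ v, ((scheduleMeasure V).real (E u v) + τ) ≤ ∑ u : V, ∑ v : V,
        ((if u = v then 1 else 0) + (∑ r ∈ Finset.range (2 * R), (M : ℝ) ^ r *
          ∑ x ∈ G.neighborFinset u, nonbacktrackingProb G r u x v) +
        2 * ((T.choose R : ℝ) / n ^ R) + τ) := by
      refine Finset.sum_le_sum fun u _ => Finset.sum_le_sum fun v _ => ?_
      have := hEle u v
      rw [← hn] at this
      linarith
    have h2 := sum_sum_nonbacktrackingProb_le hG hM R
    rw [← hn] at h2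
    refine h1.trans ?_
    simp only [Finset.sum_add_distrib, Finset.sum_const, Finset.card_univ, nsmul_eq_mul, ← hn,
      Finset.sum_ite_eq, Finset.mem_univ, if_true, mul_one]
    nlinarith
  have hcompl : (processLaw V δ).real good = 1 - (processLaw V δ).real goodᶜ := by
    have : IsProbabilityMeasure (processLaw V δ) := by
      rw [processLaw]
      infer_instance
    rw [probReal_compl_eq_one_sub hgm]
    ring
  rw [probCorrect, ← hgood, hcompl]
  have hfin : 1 / ((δ / 4) ^ 2 * n) + C * (n + 2 * R * ((M : ℝ) ^ (2 * R) * (2 * n)) +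
      n ^ 2 * (2 * ((T.choose R : ℝ) / n ^ R)) + n ^ 2 * τ) =
      16 / δ ^ 2 * (2 / n + 4 * R * (M : ℝ) ^ (2 * R) / n + 2 * ((T.choose R : ℝ) / n ^ R) +
        τ) := by
    rw [hC]
    generalize (T.choose R : ℝ) / n ^ R = z
    field_simp
    ring
  have := mul_le_mul_of_nonneg_left hsumle hC0
  rw [hgval] at hbad
  linarith

end Bound

/-! ### Choice of the thresholds -/

section Asymptotics

open Filter

lemma choose_div_pow_le {T R : ℕ} {n ρ : ℝ} (hR : 0 < R) (hn : 0 < n) (hT : T ≤ ρ * n) :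
    (T.choose R : ℝ) / n ^ R ≤ (Real.exp 1 * ρ / R) ^ R := by
  have hR' : (0 : ℝ) < R := by exact_mod_cast hR
  have hfac : (0 : ℝ) < R.factorial := by exact_mod_cast R.factorial_pos
  have h1 : (T.choose R : ℝ) ≤ (T : ℝ) ^ R / R.factorial := Nat.choose_le_pow_div R T
  have h2 : (R : ℝ) ^ R / R.factorial ≤ Real.exp R := Real.pow_div_factorial_le_exp R hR'.le R
  have h3 : (T : ℝ) / n ≤ ρ := by rwa [div_le_iff₀ hn]
  have h0 : 0 ≤ (T : ℝ) / n := by positivity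
  have hρ : 0 ≤ ρ := h0.trans h3
  calc (T.choose R : ℝ) / n ^ R ≤ (T : ℝ) ^ R / R.factorial / n ^ R := by gcongr
    _ = ((T : ℝ) / n) ^ R / (R : ℝ) ^ R * ((R : ℝ) ^ R / R.factorial) := by
        rw [div_pow]
        field_simp
    _ ≤ ρ ^ R / (R : ℝ) ^ R * Real.exp R := by gcongr
    _ = (Real.exp 1 * ρ / R) ^ R := by
        rw [div_pow, mul_pow, ← Real.exp_nat_mul, mul_one]
        ring

/-- With distance threshold `ln n / (6 ln ln n)` and degree threshold `2 ln n / δ²`, and with `x`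
standing for `ln n`, all error terms other than the long-range one are at most `n^(-1/4)`. -/
lemma eventually_error_le {δ : ℝ} (hδ : 0 < δ) :
    ∀ᶠ x : ℝ in atTop, 2 ≤ x ∧ 1 ≤ Real.log x ∧
      2 / Real.exp x ≤ Real.exp (-(x / 4)) ∧
      4 * (⌈x / (6 * Real.log x)⌉₊ : ℝ) *
        (⌈2 / δ ^ 2 * x⌉₊ : ℝ) ^ (2 * ⌈x / (6 * Real.log x)⌉₊) / Real.exp x ≤
          Real.exp (-(x / 4)) ∧
      3 * (Real.exp x * x * Real.exp (-(2 * δ ^ 2 * ⌈2 / δ ^ 2 * x⌉₊))) ≤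
        Real.exp (-(x / 4)) := by
  have hlog : ∀ᶠ x : ℝ in atTop, 1 ≤ Real.log x := Real.tendsto_log_atTop.eventually_ge_atTop 1
  have hpow : ∀ᶠ x : ℝ in atTop, 2 / δ ^ 2 + 1 ≤ x ^ (1 / 4 : ℝ) :=
    (tendsto_rpow_atTop (by norm_num)).eventually_ge_atTop _
  have hexp : ∀ᶠ x : ℝ in atTop, 4 * x ^ 4 ≤ Real.exp (1 / 3 * x) := by
    have := (isLittleO_pow_exp_pos_mul_atTop 4 (b := 1 / 3) (by norm_num)).bound
      (c := 1 / 4) (by norm_num)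
    filter_upwards [this, eventually_ge_atTop 0] with x hx h0
    rw [Real.norm_of_nonneg (by positivity), Real.norm_of_nonneg (Real.exp_pos _).le] at hx
    linarith
  filter_upwards [hlog, hpow, hexp, eventually_ge_atTop (2 : ℝ)] with x hℓ hpow hexp hx
  set ℓ := Real.log x with hℓdef
  set R := ⌈x / (6 * ℓ)⌉₊ with hR
  set M := ⌈2 / δ ^ 2 * x⌉₊ with hM
  have hx0 : 0 < x := by linarith
  have hexpℓ : Real.exp ℓ = x := Real.exp_log hx0
  have hMge : 2 / δ ^ 2 * x ≤ M := Nat.le_ceil _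
  have hRle : (R : ℝ) ≤ x / (6 * ℓ) + 1 := (Nat.ceil_lt_add_one (by positivity)).le
  have hRx : (R : ℝ) ≤ x := by
    have : x / (6 * ℓ) ≤ x / 6 := by
      gcongr
      linarith
    linarith
  have hMle : (M : ℝ) ≤ Real.exp (5 / 4 * ℓ) := by
    calc (M : ℝ) ≤ 2 / δ ^ 2 * x + 1 := (Nat.ceil_lt_add_one (by positivity)).le
      _ ≤ (2 / δ ^ 2 + 1) * x := by nlinarith
      _ ≤ x ^ (1 / 4 : ℝ) * x := by gcongr
      _ = Real.exp (5 / 4 * ℓ) := by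
          rw [Real.rpow_def_of_pos hx0, ← hℓdef]
          calc Real.exp (ℓ * (1 / 4)) * x = Real.exp (ℓ * (1 / 4)) * Real.exp ℓ := by rw [hexpℓ]
            _ = Real.exp (5 / 4 * ℓ) := by
                rw [← Real.exp_add]
                congr 1
                ring
  have hx4 : x ≤ x ^ 4 := by
    calc x = x ^ 1 := (pow_one x).symm
      _ ≤ x ^ 4 := pow_le_pow_right₀ (by linarith) (by norm_num)
  refine ⟨hx, hℓ, ?_, ?_, ?_⟩
  · rw [div_le_iff₀ (Real.exp_pos _), ← Real.exp_add]
    calc 2 ≤ 4 * x ^ 4 := by linarith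
      _ ≤ Real.exp (1 / 3 * x) := hexp
      _ ≤ _ := Real.exp_le_exp.2 (by linarith)
  · have hMR : (M : ℝ) ^ (2 * R) ≤ Real.exp (5 / 12 * x) * x ^ 3 := by
      calc (M : ℝ) ^ (2 * R) ≤ Real.exp (5 / 4 * ℓ) ^ (2 * R) := by gcongr
        _ = Real.exp (5 / 2 * ℓ * R) := by
            rw [← Real.exp_nat_mul]
            congr 1
            push_cast
            ring
        _ ≤ Real.exp (5 / 12 * x + 3 * ℓ) := by
            apply Real.exp_le_exp.2
            calc 5 / 2 * ℓ * R ≤ 5 / 2 * ℓ * (x / (6 * ℓ) + 1) := by gcongr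
              _ = 5 / 12 * x + 5 / 2 * ℓ := by
                  field_simp
                  ring
              _ ≤ 5 / 12 * x + 3 * ℓ := by linarith
        _ = _ := by
            rw [Real.exp_add, show (3 : ℝ) * ℓ = ((3 : ℕ) : ℝ) * ℓ by norm_num,
              Real.exp_nat_mul, hexpℓ]
    rw [div_le_iff₀ (Real.exp_pos _)]
    calc 4 * (R : ℝ) * (M : ℝ) ^ (2 * R) ≤ 4 * x * (Real.exp (5 / 12 * x) * x ^ 3) := by gcongr
      _ = 4 * x ^ 4 * Real.exp (5 / 12 * x) := by ring
      _ ≤ Real.exp (1 / 3 * x) * Real.exp (5 / 12 * x) := by gcongr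
      _ = _ := by
          rw [← Real.exp_add, ← Real.exp_add]
          congr 1
          ring
  · have h4 : 4 * x ≤ 2 * δ ^ 2 * M := by
      calc 4 * x = 2 * δ ^ 2 * (2 / δ ^ 2 * x) := by
            field_simp
            ring
        _ ≤ _ := by gcongr
    calc 3 * (Real.exp x * x * Real.exp (-(2 * δ ^ 2 * M)))
        ≤ 3 * (Real.exp x * x * Real.exp (-(4 * x))) := by gcongr
      _ = (3 * x) * (Real.exp x * Real.exp (-(4 * x))) := by ring
      _ ≤ Real.exp (1 / 3 * x) * (Real.exp x * Real.exp (-(4 * x))) := by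
          gcongr
          linarith
      _ = Real.exp (1 / 3 * x + (x + -(4 * x))) := by rw [Real.exp_add, Real.exp_add]
      _ ≤ _ := Real.exp_le_exp.2 (by linarith)

/-- Only the long-range error term depends on the range of `T`. -/
lemma eventually_one_sub_le_probCorrect {δ : ℝ} (h₀ : 0 < δ) (h₁ : δ < 1 / 2) :
    ∀ᶠ n : ℕ in atTop, 2 ≤ Real.log n ∧ 1 ≤ Real.log (Real.log n) ∧
      ∀ (V : Type u) [Fintype V] [MeasurableSpace V] [DiscreteMeasurableSpace V]
        (G : SimpleGraph V), Fintype.card V = n → G.IsTree →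
      ∀ (T : ℕ) (ρ : ℝ), (T : ℝ) ≤ ρ * n → ρ ≤ Real.log n →
        1 - 16 / δ ^ 2 * (3 * Real.exp (-(Real.log n / 4)) +
          2 * (6 * Real.exp 1 * ρ * Real.log (Real.log n) / Real.log n) ^
            ⌈Real.log n / (6 * Real.log (Real.log n))⌉₊) ≤
          probCorrect G δ T ((1 / 2 + δ / 2 - Real.exp (-((T : ℝ) / n))) * n) := by
  have htend : Tendsto (fun n : ℕ => Real.log n) atTop atTop :=
    Real.tendsto_log_atTop.comp tendsto_natCast_atTop_atTop
  filter_upwards [htend.eventually (eventually_error_le h₀), eventually_gt_atTop 0]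
    with n ⟨hx, hℓ, h2, h3, h4⟩ hn
  refine ⟨hx, hℓ, fun V _ _ _ G hcard hG T ρ hT hρ => ?_⟩
  have hn0 : (0 : ℝ) < n := by exact_mod_cast hn
  have hexp : Real.exp (Real.log n) = n := Real.exp_log hn0
  rw [hexp] at h2 h3 h4
  set x := Real.log n with hxdef
  set ℓ := Real.log x with hℓdef
  set R := ⌈x / (6 * ℓ)⌉₊ with hR
  set M := ⌈2 / δ ^ 2 * x⌉₊ with hM
  have hx0 : 0 < x := by linarith
  have hℓ0 : 0 < ℓ := by linarith
  have hRpos : 0 < R := Nat.ceil_pos.2 (by positivity)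
  have hMpos : 1 ≤ M := Nat.ceil_pos.2 (by positivity)
  have hRge : x / (6 * ℓ) ≤ R := Nat.le_ceil _
  have hρ0 : 0 ≤ ρ := by
    by_contra hneg
    have : ρ * n < 0 := mul_neg_of_neg_of_pos (not_le.1 hneg) hn0
    linarith [(Nat.cast_nonneg T : (0 : ℝ) ≤ T)]
  have hchoose : (T.choose R : ℝ) / (n : ℝ) ^ R ≤ (6 * Real.exp 1 * ρ * ℓ / x) ^ R := by
    refine (choose_div_pow_le hRpos hn0 hT).trans ?_
    refine pow_le_pow_left₀ (by positivity) ?_ R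
    calc Real.exp 1 * ρ / R ≤ Real.exp 1 * ρ / (x / (6 * ℓ)) := by gcongr
      _ = _ := by
          field_simp
  have hTe : 3 * (T * Real.exp (-(2 * δ ^ 2 * M))) ≤ Real.exp (-(x / 4)) := by
    refine le_trans ?_ h4
    have : (T : ℝ) ≤ n * x := by nlinarith
    gcongr
  have hmain := one_sub_le_probCorrect hG h₀ h₁ T R hMpos (n := n) (by rw [hcard])
  refine le_trans ?_ hmain
  have hc : 0 ≤ 16 / δ ^ 2 := by positivity
  have : 2 / (n : ℝ) + 4 * R * (M : ℝ) ^ (2 * R) / n + 2 * ((T.choose R : ℝ) / (n : ℝ) ^ R) +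
        3 * (T * Real.exp (-(2 * δ ^ 2 * M))) ≤
      3 * Real.exp (-(x / 4)) + 2 * (6 * Real.exp 1 * ρ * ℓ / x) ^ R := by linarith
  linarith [mul_le_mul_of_nonneg_left this hc]

end Asymptotics

end MajorityDynamics

theorem theorem4p1 (δ : ℝ) (hδ₀ : 0 < δ) (hδ₁ : δ < 1 / 2) :
    (∃ K : ℝ, 0 < K ∧ ∃ N : ℕ, ∀ n : ℕ, N ≤ n →
      ∀ (V : Type u) [Fintype V] [MeasurableSpace V] [DiscreteMeasurableSpace V]
        (G : SimpleGraph V), Fintype.card V = n → G.IsTree →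
      ∀ T : ℕ, (T : ℝ) ≤ (n : ℝ) * Real.log n / (32 * Real.log (Real.log n)) →
        1 - K * Real.exp (-(Real.log n / (24 * Real.log (Real.log n)))) ≤
          MajorityDynamics.probCorrect G δ T
            ((1 / 2 + δ / 2 - Real.exp (-((T : ℝ) / n))) * n)) ∧
    (∀ γ : ℝ, 0 < γ → ∃ α : ℝ, 0 < α ∧ ∃ N : ℕ, ∀ n : ℕ, N ≤ n →
      ∀ (V : Type u) [Fintype V] [MeasurableSpace V] [DiscreteMeasurableSpace V]
        (G : SimpleGraph V), Fintype.card V = n → G.IsTree →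
      ∀ T : ℕ, (T : ℝ) ≤ (n : ℝ) * Real.log n ^ (1 - γ) / Real.log (Real.log n) →
        1 - (n : ℝ) ^ (-α) ≤
          MajorityDynamics.probCorrect G δ T
            ((1 / 2 + δ / 2 - Real.exp (-((T : ℝ) / n))) * n)) := by
  have hev := MajorityDynamics.eventually_one_sub_le_probCorrect.{u} hδ₀ hδ₁
  constructor
  · obtain ⟨N, hN⟩ := Filter.eventually_atTop.1 hev
    refine ⟨16 / δ ^ 2 * 5, by positivity, N, fun n hn V _ _ _ G hcard hG T hT => ?_⟩
    obtain ⟨hx, hℓ, h⟩ := hN n hn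
    set x := Real.log n with hxdef
    set ℓ := Real.log x with hℓdef
    have hx0 : 0 < x := by linarith
    have hℓ0 : 0 < ℓ := by linarith
    refine le_trans ?_ (h V G hcard hG T (x / (32 * ℓ)) (hT.trans_eq (by ring)) ?_)
    · have hbase : 6 * Real.exp 1 * (x / (32 * ℓ)) * ℓ / x ≤ Real.exp (-(1 / 4)) := by
        have e1 : 6 * Real.exp 1 * (x / (32 * ℓ)) * ℓ / x = 6 / 32 * Real.exp 1 := by
          field_simp
        rw [e1]
        linarith [Real.exp_one_lt_d9, Real.add_one_le_exp (-(1 / 4) : ℝ)]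
      have hpow : (6 * Real.exp 1 * (x / (32 * ℓ)) * ℓ / x) ^ ⌈x / (6 * ℓ)⌉₊ ≤
          Real.exp (-(x / (24 * ℓ))) := by
        calc _ ≤ Real.exp (-(1 / 4)) ^ ⌈x / (6 * ℓ)⌉₊ :=
              pow_le_pow_left₀ (by positivity) hbase _
          _ = Real.exp (-(⌈x / (6 * ℓ)⌉₊ / 4)) := by
              rw [← Real.exp_nat_mul]
              congr 1
              ring
          _ ≤ _ := by
              apply Real.exp_le_exp.2
              have : x / (6 * ℓ) ≤ ⌈x / (6 * ℓ)⌉₊ := Nat.le_ceil _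
              have e : x / (24 * ℓ) = x / (6 * ℓ) / 4 := by
                field_simp
                norm_num
              rw [e]
              linarith
      have hquarter : Real.exp (-(x / 4)) ≤ Real.exp (-(x / (24 * ℓ))) := by
        apply Real.exp_le_exp.2
        have : x / (24 * ℓ) ≤ x / 4 := by
          gcongr
          linarith
        linarith
      have hc : 0 ≤ 16 / δ ^ 2 := by positivity
      have := mul_le_mul_of_nonneg_left (add_le_add
        (mul_le_mul_of_nonneg_left hquarter (by norm_num : (0 : ℝ) ≤ 3))
        (mul_le_mul_of_nonneg_left hpow (by norm_num : (0 : ℝ) ≤ 2))) hc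
      linarith
    · exact div_le_self hx0.le (by linarith)
  · intro γ hγ
    set β := min (1 / 4) (γ / 12) with hβ
    have hβ0 : 0 < β := by positivity
    refine ⟨β / 2, by positivity, ?_⟩
    have htend : Filter.Tendsto (fun n : ℕ => Real.log n) Filter.atTop Filter.atTop :=
      Real.tendsto_log_atTop.comp tendsto_natCast_atTop_atTop
    have hev2 := htend.eventually
      ((tendsto_rpow_atTop (show 0 < γ / 2 by positivity)).eventually_ge_atTop
        (6 * Real.exp 1))
    have hev3 := htend.eventually (Filter.eventually_ge_atTop (16 / δ ^ 2 * 5 / (β / 2)))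
    obtain ⟨N, hN⟩ := Filter.eventually_atTop.1 ((hev.and (hev2.and hev3)).and
      (Filter.eventually_gt_atTop 0))
    refine ⟨N, fun n hn V _ _ _ G hcard hG T hT => ?_⟩
    obtain ⟨⟨⟨hx, hℓ, h⟩, hγx, hKx⟩, hnpos⟩ := hN n hn
    have hn0 : (0 : ℝ) < n := by exact_mod_cast hnpos
    rw [Real.rpow_def_of_pos hn0]
    set x := Real.log n with hxdef
    set ℓ := Real.log x with hℓdef
    have hx0 : 0 < x := by linarith
    have hℓ0 : 0 < ℓ := by linarith
    refine le_trans ?_ (h V G hcard hG T (x ^ (1 - γ) / ℓ) (hT.trans_eq (by ring)) ?_)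
    · have hbase : 6 * Real.exp 1 * (x ^ (1 - γ) / ℓ) * ℓ / x ≤ Real.exp (-(γ / 2 * ℓ)) := by
        have e1 : 6 * Real.exp 1 * (x ^ (1 - γ) / ℓ) * ℓ / x = 6 * Real.exp 1 * x ^ (-γ) := by
          rw [sub_eq_add_neg, Real.rpow_add hx0, Real.rpow_one]
          field_simp
        have e2 : Real.exp (-(γ / 2 * ℓ)) = x ^ (γ / 2) * x ^ (-γ) := by
          rw [← Real.rpow_add hx0, Real.rpow_def_of_pos hx0]
          congr 1
          ring
        rw [e1, e2]
        gcongr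
      have hpow : (6 * Real.exp 1 * (x ^ (1 - γ) / ℓ) * ℓ / x) ^ ⌈x / (6 * ℓ)⌉₊ ≤
          Real.exp (-(β * x)) := by
        calc _ ≤ Real.exp (-(γ / 2 * ℓ)) ^ ⌈x / (6 * ℓ)⌉₊ :=
              pow_le_pow_left₀ (by positivity) hbase _
          _ = Real.exp (-(γ / 2 * ℓ * ⌈x / (6 * ℓ)⌉₊)) := by
              rw [← Real.exp_nat_mul]
              congr 1
              ring
          _ ≤ Real.exp (-(γ / 12 * x)) := by
              apply Real.exp_le_exp.2
              apply neg_le_neg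
              calc γ / 12 * x = γ / 2 * ℓ * (x / (6 * ℓ)) := by
                    field_simp
                    norm_num
                _ ≤ _ := by
                    gcongr
                    exact Nat.le_ceil _
          _ ≤ _ := by
              apply Real.exp_le_exp.2
              have := mul_le_mul_of_nonneg_right (min_le_right (1 / 4) (γ / 12)) hx0.le
              linarith
      have hquarter : Real.exp (-(x / 4)) ≤ Real.exp (-(β * x)) := by
        apply Real.exp_le_exp.2
        have := mul_le_mul_of_nonneg_right (min_le_left (1 / 4) (γ / 12)) hx0.le
        linarith
      have hc : 0 ≤ 16 / δ ^ 2 := by positivity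
      have h1 := mul_le_mul_of_nonneg_left (add_le_add
        (mul_le_mul_of_nonneg_left hquarter (by norm_num : (0 : ℝ) ≤ 3))
        (mul_le_mul_of_nonneg_left hpow (by norm_num : (0 : ℝ) ≤ 2))) hc
      -- half of the exponent absorbs the constant factor
      have h2 : 16 / δ ^ 2 * 5 * Real.exp (-(β * x)) ≤ Real.exp (x * -(β / 2)) := by
        have h3 : 16 / δ ^ 2 * 5 ≤ Real.exp (β / 2 * x) := by
          rw [div_le_iff₀ (by positivity)] at hKx
          linarith [Real.add_one_le_exp (β / 2 * x)]
        calc _ ≤ Real.exp (β / 2 * x) * Real.exp (-(β * x)) := by gcongr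
          _ = _ := by
              rw [← Real.exp_add]
              congr 1
              ring
      linarith
    · calc x ^ (1 - γ) / ℓ ≤ x ^ (1 - γ) := div_le_self (by positivity) hℓ
        _ ≤ x ^ (1 : ℝ) := Real.rpow_le_rpow_of_exponent_le (by linarith) (by linarith)
        _ = x := Real.rpow_one x
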